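/- Write $\mathbb Z^+=\{0,1,2,\dots\}$. A probability on $\mathbb Z^+$ is a function $F\colon\mathbb Z^+\to[0,\infty)$ with $\sum_{k\ge 0}F(k)=1$. Let $F^{(n)}$ denote its $n$-fold convolution power, and let $\widehat F(\xi)=\sum_{k\ge0}F(k)e^{-ik\xi}$ for real $\xi$. Let $\mathcal A$ be the set of probabilities $F$ on $\mathbb Z^+$ with $$\sup_{n\ge1}\, n\sum_{k\ge0}\bigl|F^{(n)}(k)-F^{(n+1)}(k)\bigr|<\infty .$$ Call $F$ aperiodic if, for every $m\in\mathbb Z$, the set $\{m+k : F(k)\ne0\}$ generates the additive group $\mathbb Z$. **Theorem 5.5.** Let $F$ be a probability on $\mathbb Z^+$ such that $$F(k)=\sum_{j=1}^N c_j\,k^{-1-\alpha_j}+P(k)\qquad\text{for all integers } k\ge1,$$ where $N\ge1$, $0<\alpha_1<\cdots<\alpha_N<1$, $c_1,\dots,c_N>0$, and $P\colon\mathbb Z^+\to\mathbb R$ satisfies $\sum_{k\ge1}k|P(k)|<\infty$. Then, with $\alpha=\alpha_1$: 1. $F$ is aperiodic, and there exist $\varepsilon\in(0,1)$ and $c>0$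 such that $1-\operatorname{Re}\widehat F(\xi)\ge\varepsilon|\xi|^{\alpha}$ for all $\xi\in[-\varepsilon,\varepsilon]$, and $\widehat F$ is differentiable at $\xi$ with $|\partial_\xi\widehat F(\xi)|\le c|\xi|^{\alpha-1}$ for all $\xi\in[-\pi,\pi]\setminus\{0\}$. 2. $F\in\mathcal A$. -/

import Mathlib

open scoped ENNReal

namespace RittProbability

/-- `F : ℤ⁺ → ℝ` (with `ℤ⁺ = {0, 1, 2, …}`) is a probability: nonnegative with total mass `1`. -/
structure IsProbability (F : ℕ → ℝ) : Prop where
  nonneg : ∀ k, 0 ≤ F k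
  hasSum : HasSum F 1

/-- The Dirac mass `δ₀`, the unit for convolution. -/
def dirac : ℕ → ℝ := fun k => if k = 0 then 1 else 0

/-- Convolution of two functions supported on `ℤ⁺`:
`(F * G)(m) = ∑_{k ∈ ℤ} F(k) G(m - k) = ∑_{k + l = m} F(k) G(l)`. -/
def conv (F G : ℕ → ℝ) : ℕ → ℝ :=
  fun m => ∑ p ∈ Finset.HasAntidiagonal.antidiagonal m, F p.1 * G p.2

/-- The convolution power `F^{(n)} = F * ⋯ * F` (`n` factors), with `F^{(0)} = δ₀`. -/
def convPow (F : ℕ → ℝ) : ℕ → (ℕ → ℝ)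
  | 0 => dirac
  | n + 1 => conv (convPow F n) F

/-- The `L¹` norm, with value `∞` when the function is not summable. -/
noncomputable def l1Norm (F : ℕ → ℝ) : ℝ≥0∞ := ∑' k, ‖F k‖ₑ

/-- The class of Ritt probabilities on `ℤ⁺`: the probabilities `F` such that
`sup_{n ≥ 1} n ‖F^{(n)} - F^{(n+1)}‖_{L¹} < ∞`. -/
def rittClass : Set (ℕ → ℝ) :=
  {F | IsProbability F ∧
    ⨆ (n : ℕ) (_ : 1 ≤ n), (n : ℝ≥0∞) * l1Norm (convPow F n - convPow F (n + 1)) < ∞}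

/-- The support, as a subset of `ℤ`, of the translate `δ_m * F` of `F` by `m ∈ ℤ`. -/
def translateSupport (F : ℕ → ℝ) (m : ℤ) : Set ℤ :=
  {z | ∃ k : ℕ, F k ≠ 0 ∧ z = m + (k : ℤ)}

/-- `F` is aperiodic: every translate `δ_m * F`, `m ∈ ℤ`, is adapted, that is, its support
generates the additive group `ℤ`. -/
def IsAperiodic (F : ℕ → ℝ) : Prop :=
  ∀ m : ℤ, AddSubgroup.closure (translateSupport F m) = ⊤

/-- The Fourier transform `F̂(ξ) = ∑_{k ≥ 0} F(k) e^{-ikξ}`. -/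
noncomputable def fourierZ (F : ℕ → ℝ) (ξ : ℝ) : ℂ :=
  ∑' k : ℕ, (F k : ℂ) * Complex.exp (-(Complex.I * (k : ℂ) * (ξ : ℂ)))

/-- The sufficient criterion of order `α` for a probability `F` on `ℤ⁺` to be Ritt: `F` is
aperiodic, `1 - Re F̂(ξ) ≥ ε |ξ|^α` for `|ξ| ≤ ε`, and `F̂` is differentiable with
`|∂_ξ F̂(ξ)| ≤ c |ξ|^{α - 1}` for `0 < |ξ| ≤ π`. -/
structure FourierCriterion (α : ℝ) (F : ℕ → ℝ) : Prop where
  isProbability : IsProbability F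
  aperiodic : IsAperiodic F
  bounds : ∃ ε : ℝ, 0 < ε ∧ ε < 1 ∧ ∃ c : ℝ, 0 < c ∧
    (∀ ξ ∈ Set.Icc (-ε) ε, ε * |ξ| ^ α ≤ 1 - (fourierZ F ξ).re) ∧
    (∀ ξ ∈ Set.Icc (-Real.pi) Real.pi, ξ ≠ 0 →
      DifferentiableAt ℝ (fourierZ F) ξ ∧ ‖deriv (fourierZ F) ξ‖ ≤ c * |ξ| ^ (α - 1))

end RittProbability

/-!
The main part `b` of `F` decreases and is comparable to `k ^ (-1 - α)`. Cutting `∑ k b(k) e^{-ikξ}`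
at `k ≈ 1 / |ξ|` and summing the tail by parts bounds the derivative of its transform by a multiple
of `|ξ| ^ (α - 1)`, and keeping only the terms `k ≤ 1 / |ξ|` of `∑ F(k) (1 - cos kξ)` bounds
`1 - Re F̂(ξ)` below by a multiple of `|ξ| ^ α`. An error with a finite first moment contributes
only `O(1)` to the former and `O(|ξ|)` to the latter.

Two consecutive integers are charged, so `F` is aperiodic and `|F̂| < 1` off the origin, and the
lower bound gives `|F̂(ξ)| ≤ exp (-c |ξ| ^ α)` on `[-π, π]`. Hence `F̂ ^ n (1 - F̂)`, the transform
of `F^{(n)} - F^{(n+1)}`, lives at the scale `|ξ| ≈ n ^ (-1/α)`, where its size is `1 / n`, and it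
has a singularity of order `α / 2` and size `n ^ (-1/2)` at the origin. Bernstein's argument (the
inequalities of Cauchy–Schwarz and Bessel, applied to the transform for the indices below
`n ^ (1/α)` and to its increments on the dyadic blocks beyond) bounds the `ℓ¹` norm by `O(1 / n)`.
-/

namespace RittProbability

/-- The Fourier series `∑_{k ≥ 0} f(k) e^{-ikξ}` with complex coefficients, written as the power
series of `f` at the point `e^{-iξ}` of the unit circle; it extends `fourierZ`. -/
noncomputable def fourierC (f : ℕ → ℂ) (ξ : ℝ) : ℂ :=
  ∑' k, f k * (Circle.exp (-ξ) : ℂ) ^ k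

theorem fourierZ_eq_fourierC (F : ℕ → ℝ) : fourierZ F = fourierC fun k => (F k : ℂ) := by
  ext ξ
  refine tsum_congr fun k => ?_
  rw [Circle.coe_exp, ← Complex.exp_nat_mul]
  push_cast
  ring_nf

section FourierSeries

variable {f : ℕ → ℂ}

theorem norm_mul_circle_pow (w : ℂ) (z : Circle) (k : ℕ) : ‖w * (z : ℂ) ^ k‖ = ‖w‖ := by
  simp [Circle.norm_coe]

theorem summable_mul_circle_pow (hf : Summable fun k => ‖f k‖) (z : Circle) :
    Summable fun k => f k * (z : ℂ) ^ k :=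
  .of_norm (by simpa only [norm_mul_circle_pow] using hf)

theorem norm_fourierC_le (hf : Summable fun k => ‖f k‖) (ξ : ℝ) :
    ‖fourierC f ξ‖ ≤ ∑' k, ‖f k‖ :=
  tsum_of_norm_bounded hf.hasSum fun _ => (norm_mul_circle_pow _ _ _).le

theorem continuous_fourierC (hf : Summable fun k => ‖f k‖) : Continuous (fourierC f) :=
  continuous_tsum (fun k => by fun_prop) hf fun _ _ => (norm_mul_circle_pow _ _ _).le

theorem periodic_fourierC (f : ℕ → ℂ) : Function.Periodic (fourierC f) (2 * Real.pi) := by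
  intro ξ
  simp only [fourierC, neg_add', Circle.periodic_exp.sub_eq]

theorem fourierC_sub {g : ℕ → ℂ} (hf : Summable fun k => ‖f k‖) (hg : Summable fun k => ‖g k‖)
    (ξ : ℝ) : fourierC (f - g) ξ = fourierC f ξ - fourierC g ξ := by
  simp only [fourierC, Pi.sub_apply, sub_mul]
  exact (summable_mul_circle_pow hf _).tsum_sub (summable_mul_circle_pow hg _)

theorem fourierC_mul_pow_sub_one (hf : Summable fun k => ‖f k‖) (ξ h : ℝ) :
    fourierC (fun k => f k * ((Circle.exp (-h) : ℂ) ^ k - 1)) ξ =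
      fourierC f (ξ + h) - fourierC f ξ := by
  rw [fourierC, fourierC, fourierC,
    ← (summable_mul_circle_pow hf _).tsum_sub (summable_mul_circle_pow hf _)]
  refine tsum_congr fun k => ?_
  rw [neg_add, Circle.exp_add, Circle.coe_mul]
  ring

theorem summable_norm_of_summable_nat_mul {E : Type*} [SeminormedAddCommGroup E] {f : ℕ → E}
    (hf : Summable fun k : ℕ => (k : ℝ) * ‖f k‖) : Summable fun k => ‖f k‖ := by
  refine (summable_nat_add_iff 1).1 (.of_nonneg_of_le (fun _ => norm_nonneg _) (fun k => ?_)
    ((summable_nat_add_iff 1).2 hf))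
  exact le_mul_of_one_le_left (norm_nonneg _) (by push_cast; linarith [k.cast_nonneg (α := ℝ)])

theorem hasDerivAt_circle_exp_neg_pow (k : ℕ) (ξ : ℝ) :
    HasDerivAt (fun x : ℝ => (Circle.exp (-x) : ℂ) ^ k)
      (-(Complex.I * k) * (Circle.exp (-ξ) : ℂ) ^ k) ξ := by
  simp only [Circle.coe_exp, ← Complex.exp_nat_mul]
  have h : HasDerivAt (fun x : ℝ => (k : ℂ) * ((-x : ℝ) * Complex.I)) (-(Complex.I * k)) ξ :=
    (((hasDerivAt_id ξ).neg.ofReal_comp.mul_const Complex.I).const_mul (k : ℂ)).congr_deriv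
      (by push_cast; ring)
  exact h.cexp.congr_deriv (mul_comm _ _)

theorem hasDerivAt_circle_exp_neg (ξ : ℝ) :
    HasDerivAt (fun x : ℝ => (Circle.exp (-x) : ℂ)) (-Complex.I * Circle.exp (-ξ)) ξ := by
  simpa only [pow_one, Nat.cast_one, mul_one] using hasDerivAt_circle_exp_neg_pow 1 ξ

theorem hasDerivAt_fourierC (hf : Summable fun k : ℕ => (k : ℝ) * ‖f k‖) (ξ : ℝ) :
    HasDerivAt (fourierC f) (fourierC (fun k => -(Complex.I * k) * f k) ξ) ξ := by
  have hsum := summable_mul_circle_pow (summable_norm_of_summable_nat_mul hf) (Circle.exp (-0))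
  have h := hasDerivAt_tsum (𝕜 := ℝ) (y₀ := 0) hf
    (fun k x => (hasDerivAt_circle_exp_neg_pow k x).const_mul (f k))
    (fun k x => by simp [mul_comm]) hsum ξ
  exact h.congr_deriv (tsum_congr fun k => by ring)

theorem norm_deriv_fourierC_le (hf : Summable fun k : ℕ => (k : ℝ) * ‖f k‖) (ξ : ℝ) :
    ‖deriv (fourierC f) ξ‖ ≤ ∑' k : ℕ, (k : ℝ) * ‖f k‖ := by
  rw [(hasDerivAt_fourierC hf ξ).deriv]
  exact (norm_fourierC_le (by simpa using hf) ξ).trans_eq (by simp)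

local instance : Fact (0 < 2 * Real.pi) := ⟨Real.two_pi_pos⟩

theorem exists_hasSum_fourier_eq_fourierC (hf : Summable fun k => ‖f k‖) :
    ∃ G : C(AddCircle (2 * Real.pi), ℂ),
      HasSum (fun k : ℕ => f k • fourier (-k : ℤ)) G ∧ ∀ x : ℝ, G x = fourierC f x := by
  have hsum : Summable fun k : ℕ => f k • fourier (T := 2 * Real.pi) (-k : ℤ) :=
    .of_norm (by simpa only [norm_smul, fourier_norm, mul_one] using hf)
  refine ⟨_, hsum.hasSum, fun x => ?_⟩
  have hpi : (Real.pi : ℂ) ≠ 0 := by exact_mod_cast Real.pi_ne_zero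
  refine (ContinuousMap.tsum_apply hsum (x : AddCircle (2 * Real.pi))).symm.trans
    (tsum_congr fun k => ?_)
  rw [ContinuousMap.smul_apply, fourier_coe_apply, smul_eq_mul, Circle.coe_exp,
    ← Complex.exp_nat_mul]
  congr 2
  push_cast
  field_simp

open MeasureTheory in
theorem norm_toLp_sq_eq_integral (G : C(AddCircle (2 * Real.pi), ℂ)) :
    ‖ContinuousMap.toLp (E := ℂ) 2 AddCircle.haarAddCircle ℂ G‖ ^ 2 =
      (2 * Real.pi)⁻¹ * ∫ x in (-Real.pi)..Real.pi, ‖G x‖ ^ 2 := by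
  have h := AddCircle.intervalIntegral_preimage (2 * Real.pi) (-Real.pi) fun x => ‖G x‖ ^ 2
  rw [show -Real.pi + 2 * Real.pi = Real.pi by ring] at h
  rw [h, ← smul_eq_mul (2 * Real.pi)⁻¹, ← AddCircle.integral_haarAddCircle, ← Complex.ofReal_inj,
    Complex.ofReal_pow, ← Complex.coe_algebraMap, ← inner_self_eq_norm_sq_to_K,
    ContinuousMap.inner_toLp]
  simp only [RCLike.mul_conj]
  exact_mod_cast integral_complex_ofReal

theorem sum_norm_sq_le_integral_norm_fourierC_sq (hf : Summable fun k => ‖f k‖) (S : Finset ℕ) :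
    ∑ k ∈ S, ‖f k‖ ^ 2 ≤ ∫ x in (-Real.pi)..Real.pi, ‖fourierC f x‖ ^ 2 := by
  obtain ⟨G, hG, hGf⟩ := exists_hasSum_fourier_eq_fourierC hf
  let toL2 := ContinuousMap.toLp (E := ℂ) 2 (AddCircle.haarAddCircle (T := 2 * Real.pi)) ℂ
  have horth : Orthonormal ℂ fun k : ℕ => fourierLp (T := 2 * Real.pi) 2 (-k) :=
    orthonormal_fourier.comp _ fun a b h => by simpa using h
  have hcoef : ∀ k : ℕ, inner ℂ (fourierLp 2 (-k)) (toL2 G) = f k := by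
    intro k
    refine ((innerSL ℂ (fourierLp 2 (-k))).hasSum (toL2.hasSum hG)).unique
      ((hasSum_ite_eq k (f k)).congr_fun fun j => ?_)
    rw [map_smul, map_smul, innerSL_apply_apply, orthonormal_iff_ite.1 horth k j]
    aesop
  have hbessel : ∑ k ∈ S, ‖f k‖ ^ 2 ≤ ‖toL2 G‖ ^ 2 := by
    simpa only [hcoef] using horth.sum_inner_products_le (s := S) (toL2 G)
  rw [norm_toLp_sq_eq_integral] at hbessel
  simp only [hGf] at hbessel
  refine hbessel.trans (mul_le_of_le_one_left
    (intervalIntegral.integral_nonneg (by linarith [Real.pi_pos]) fun x _ => by positivity) ?_)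
  exact inv_le_one_of_one_le₀ (by linarith [Real.pi_gt_three])

end FourierSeries

section Convolution

variable {F G : ℕ → ℝ}

theorem fourierZ_conv (hF : Summable fun k => ‖F k‖) (hG : Summable fun k => ‖G k‖) (ξ : ℝ) :
    fourierZ (conv F G) ξ = fourierZ F ξ * fourierZ G ξ := by
  simp only [fourierZ_eq_fourierC, fourierC]
  rw [tsum_mul_tsum_eq_tsum_sum_antidiagonal_of_summable_norm
    (by simpa only [norm_mul_circle_pow, Complex.norm_real] using hF)
    (by simpa only [norm_mul_circle_pow, Complex.norm_real] using hG)]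
  refine tsum_congr fun k => ?_
  rw [conv, Complex.ofReal_sum, Finset.sum_mul]
  refine Finset.sum_congr rfl fun p hp => ?_
  rw [← Finset.HasAntidiagonal.mem_antidiagonal.1 hp]
  push_cast
  ring

theorem summable_norm_convPow (hF : Summable fun k => ‖F k‖) (n : ℕ) :
    Summable fun k => ‖convPow F n k‖ := by
  induction n with
  | zero => exact summable_of_ne_finset_zero (s := {0}) fun k hk => by simp_all [convPow, dirac]
  | succ n ih => exact summable_norm_sum_mul_antidiagonal_of_summable_norm ih hF

theorem fourierZ_convPow (hF : Summable fun k => ‖F k‖) (n : ℕ) (ξ : ℝ) :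
    fourierZ (convPow F n) ξ = fourierZ F ξ ^ n := by
  induction n with
  | zero =>
    rw [fourierZ, tsum_eq_single 0 fun k hk => by simp [convPow, dirac, hk]]
    simp [convPow, dirac]
  | succ n ih => rw [convPow, fourierZ_conv (summable_norm_convPow hF n) hF, ih, pow_succ]

end Convolution

section MonotoneCoefficients

theorem two_mul_abs_le_pi_mul_norm_circle_exp_sub_one {x : ℝ} (hx : |x| ≤ Real.pi) :
    2 * |x| ≤ Real.pi * ‖(Circle.exp x : ℂ) - 1‖ := by
  have h := Real.mul_abs_le_abs_sin (x := x / 2) (by rw [abs_div, abs_two]; linarith)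
  rw [Circle.coe_exp, mul_comm (x : ℂ), Complex.norm_exp_I_mul_ofReal_sub_one, norm_mul,
    Real.norm_ofNat, Real.norm_eq_abs]
  rw [abs_div, abs_two, div_mul_div_comm, div_le_iff₀ (by positivity)] at h
  linarith

theorem abs_le_two_mul_norm_one_sub_circle_exp_neg {ξ : ℝ} (hξ : |ξ| ≤ Real.pi) :
    |ξ| ≤ 2 * ‖1 - (Circle.exp (-ξ) : ℂ)‖ := by
  have h := two_mul_abs_le_pi_mul_norm_circle_exp_sub_one (x := -ξ) (by rwa [abs_neg])
  rw [abs_neg, norm_sub_rev] at h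
  nlinarith [norm_nonneg (1 - (Circle.exp (-ξ) : ℂ)), Real.pi_le_four]

variable {u b : ℕ → ℝ}

theorem one_sub_mul_fourierC {f : ℕ → ℂ} (hf : Summable fun k => ‖f k‖) (ξ : ℝ) :
    (1 - (Circle.exp (-ξ) : ℂ)) * fourierC f ξ =
      f 0 + Circle.exp (-ξ) * fourierC (fun k => f (k + 1) - f k) ξ := by
  have hf' : Summable fun k => ‖f (k + 1)‖ := (summable_nat_add_iff 1).2 hf
  have hshift : fourierC f ξ = f 0 + Circle.exp (-ξ) * fourierC (fun k => f (k + 1)) ξ := by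
    rw [fourierC, fourierC, (summable_mul_circle_pow hf _).tsum_eq_zero_add, pow_zero, mul_one,
      ← tsum_mul_left]
    congr 1
    exact tsum_congr fun k => by ring
  have hdiff := fourierC_sub hf' hf ξ
  simp only [Pi.sub_def] at hdiff
  rw [hdiff]
  linear_combination hshift

theorem nonneg_of_antitone_of_summable (hu : Antitone u) (hs : Summable u) (k : ℕ) : 0 ≤ u k :=
  hu.le_of_tendsto hs.tendsto_atTop_zero k

theorem sum_range_succ_mul_sub (u : ℕ → ℝ) (n : ℕ) :
    ∑ k ∈ Finset.range n, ((k : ℝ) + 1) * (u k - u (k + 1)) =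
      ∑ k ∈ Finset.range n, u k - n * u n := by
  induction n with
  | zero => simp
  | succ n ih =>
    rw [Finset.sum_range_succ, Finset.sum_range_succ, ih]
    push_cast
    ring

theorem sum_range_succ_mul_abs_sub_le (hu : Antitone u) (hs : Summable u) (n : ℕ) :
    ∑ k ∈ Finset.range n, ((k : ℝ) + 1) * |u (k + 1) - u k| ≤ ∑' k, u k := by
  have hu0 := nonneg_of_antitone_of_summable hu hs
  have habs : ∀ k, |u (k + 1) - u k| = u k - u (k + 1) := fun k => by
    rw [abs_sub_comm, abs_of_nonneg (sub_nonneg.2 (hu k.le_succ))]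
  simp only [habs, sum_range_succ_mul_sub]
  have := mul_nonneg n.cast_nonneg (hu0 n)
  linarith [hs.sum_le_tsum (Finset.range n) fun k _ => hu0 k]

theorem norm_fourierC_sub_add_norm_deriv_le (hu : Antitone u) (hs : Summable u) (ξ : ℝ) :
    (DifferentiableAt ℝ (fourierC fun k => (u (k + 1) : ℂ) - u k) ξ) ∧
      ‖fourierC (fun k => (u (k + 1) : ℂ) - u k) ξ‖ +
        ‖deriv (fourierC fun k => (u (k + 1) : ℂ) - u k) ξ‖ ≤ ∑' k, u k := by
  have hnorm : ∀ k, ‖(u (k + 1) : ℂ) - u k‖ = |u (k + 1) - u k| := fun k => by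
    rw [← Complex.ofReal_sub, Complex.norm_real, Real.norm_eq_abs]
  have hle := sum_range_succ_mul_abs_sub_le hu hs
  have hsum : Summable fun k : ℕ => ((k : ℝ) + 1) * ‖(u (k + 1) : ℂ) - u k‖ := by
    simpa only [hnorm] using summable_of_sum_range_le (fun k => by positivity) hle
  have hmom : Summable fun k : ℕ => (k : ℝ) * ‖(u (k + 1) : ℂ) - u k‖ :=
    hsum.of_nonneg_of_le (fun k => by positivity) fun k => by gcongr; linarith
  have habs := summable_norm_of_summable_nat_mul hmom
  refine ⟨(hasDerivAt_fourierC hmom ξ).differentiableAt, ?_⟩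
  calc _ ≤ ∑' k, ‖(u (k + 1) : ℂ) - u k‖ + ∑' k : ℕ, (k : ℝ) * ‖(u (k + 1) : ℂ) - u k‖ :=
        add_le_add (norm_fourierC_le habs ξ) (norm_deriv_fourierC_le hmom ξ)
    _ = ∑' k : ℕ, ((k : ℝ) + 1) * ‖(u (k + 1) : ℂ) - u k‖ := by
        rw [← habs.tsum_add hmom]
        exact tsum_congr fun k => by ring
    _ ≤ ∑' k, u k := by
        simp only [hnorm] at hsum ⊢
        exact hsum.tsum_le_of_sum_range_le hle

theorem differentiableAt_fourierC_of_antitone (hu : Antitone u) (hs : Summable u) {ξ : ℝ}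
    (hξ : (Circle.exp (-ξ) : ℂ) ≠ 1) : DifferentiableAt ℝ (fourierC fun k => (u k : ℂ)) ξ := by
  have hsum : Summable fun k => ‖(u k : ℂ)‖ := by simpa using hs.abs
  have hz := (hasDerivAt_circle_exp_neg ξ).differentiableAt
  have hg := (norm_fourierC_sub_add_norm_deriv_le hu hs ξ).1
  refine (((hz.mul hg).const_add (u 0 : ℂ)).div (hz.const_sub 1)
    (sub_ne_zero.2 hξ.symm)).congr_of_eventuallyEq ?_
  filter_upwards [(hz.const_sub 1).continuousAt.eventually_ne (sub_ne_zero.2 hξ.symm)] with x hx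
  rw [Pi.div_apply, eq_div_iff hx, mul_comm, one_sub_mul_fourierC hsum]
  rfl

theorem norm_one_sub_mul_norm_deriv_fourierC_le (hu : Antitone u) (hs : Summable u) {ξ : ℝ}
    (hξ : (Circle.exp (-ξ) : ℂ) ≠ 1) :
    ‖1 - (Circle.exp (-ξ) : ℂ)‖ * ‖deriv (fourierC fun k => (u k : ℂ)) ξ‖ ≤ 2 * ∑' k, u k := by
  have hsum : Summable fun k => ‖(u k : ℂ)‖ := by simpa using hs.abs
  have hnorm : ∑' k, ‖(u k : ℂ)‖ = ∑' k, u k := tsum_congr fun k =>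
    Complex.norm_of_nonneg (nonneg_of_antitone_of_summable hu hs k)
  obtain ⟨hg, hgle⟩ := norm_fourierC_sub_add_norm_deriv_le hu hs ξ
  have hf := differentiableAt_fourierC_of_antitone hu hs hξ
  have heq := funext fun x => one_sub_mul_fourierC hsum x
  set f := fourierC fun k => (u k : ℂ)
  set g := fourierC fun k => (u (k + 1) : ℂ) - u k
  have hz := hasDerivAt_circle_exp_neg ξ
  have hleft := (hz.const_sub 1).fun_mul hf.hasDerivAt
  rw [heq] at hleft
  have huniq := hleft.unique ((hz.fun_mul hg.hasDerivAt).const_add (u 0 : ℂ))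
  have hderiv : (1 - (Circle.exp (-ξ) : ℂ)) * deriv f ξ =
      Circle.exp (-ξ) * (deriv g ξ - Complex.I * (g ξ + f ξ)) := by
    linear_combination huniq
  calc ‖1 - (Circle.exp (-ξ) : ℂ)‖ * ‖deriv f ξ‖ = ‖deriv g ξ - Complex.I * (g ξ + f ξ)‖ := by
        rw [← norm_mul, hderiv, norm_mul, Circle.norm_coe, one_mul]
    _ ≤ ‖deriv g ξ‖ + (‖g ξ‖ + ‖f ξ‖) := by
        refine (norm_sub_le _ _).trans ?_
        rw [norm_mul, Complex.norm_I, one_mul]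
        gcongr
        exact norm_add_le _ _
    _ ≤ 2 * ∑' k, u k := by
        linarith [(norm_fourierC_le hsum ξ).trans_eq hnorm]

theorem fourierC_eq_sum_add_pow_mul {f : ℕ → ℂ} (hf : Summable fun k => ‖f k‖) (M : ℕ) (ξ : ℝ) :
    fourierC f ξ = ∑ k ∈ Finset.range M, f k * (Circle.exp (-ξ) : ℂ) ^ k +
      (Circle.exp (-ξ) : ℂ) ^ M * fourierC (fun k => f (k + M)) ξ := by
  rw [fourierC, ← (summable_mul_circle_pow hf _).sum_add_tsum_nat_add M, fourierC, ← tsum_mul_left]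
  congr 1
  exact tsum_congr fun k => by ring

theorem norm_deriv_fourierC_le_of_antitoneOn {M : ℕ} (hb : Summable b)
    (hanti : AntitoneOn b (Set.Ici M)) {ξ : ℝ} (hξ : |ξ| ≤ Real.pi) (hξ0 : ξ ≠ 0) :
    DifferentiableAt ℝ (fourierC fun k => (b k : ℂ)) ξ ∧
      ‖deriv (fourierC fun k => (b k : ℂ)) ξ‖ ≤
        ∑ k ∈ Finset.range M, (k : ℝ) * |b k| + (M + 4 / |ξ|) * ∑' k, b (k + M) := by
  have hu : Antitone fun k => b (k + M) := fun i j hij =>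
    hanti (Nat.le_add_left M i) (Nat.le_add_left M j) (by omega)
  have hs : Summable fun k => b (k + M) := (summable_nat_add_iff M).2 hb
  have hz := abs_le_two_mul_norm_one_sub_circle_exp_neg hξ
  have hξ1 : (Circle.exp (-ξ) : ℂ) ≠ 1 := fun h => by
    rw [h, sub_self, norm_zero, mul_zero] at hz
    exact hξ0 (abs_nonpos_iff.1 hz)
  have hdiff := differentiableAt_fourierC_of_antitone hu hs hξ1
  set S := ∑' k, b (k + M)
  have hval : ‖fourierC (fun k => (b (k + M) : ℂ)) ξ‖ ≤ S := by
    refine (norm_fourierC_le (by simpa using hs.abs) ξ).trans_eq (tsum_congr fun k => ?_)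
    exact Complex.norm_of_nonneg (nonneg_of_antitone_of_summable hu hs k)
  have hder : ‖deriv (fourierC fun k => (b (k + M) : ℂ)) ξ‖ ≤ 4 / |ξ| * S := by
    rw [div_mul_eq_mul_div, le_div_iff₀' (abs_pos.2 hξ0)]
    linarith [norm_one_sub_mul_norm_deriv_fourierC_le hu hs hξ1,
      mul_le_mul_of_nonneg_right hz (norm_nonneg (deriv (fourierC fun k => (b (k + M) : ℂ)) ξ))]
  have hderiv := (HasDerivAt.fun_sum fun k (_ : k ∈ Finset.range M) =>
    (hasDerivAt_circle_exp_neg_pow k ξ).const_mul (b k : ℂ)).add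
      ((hasDerivAt_circle_exp_neg_pow M ξ).fun_mul hdiff.hasDerivAt)
  have hfun : fourierC (fun k => (b k : ℂ)) = _ :=
    funext fun x => fourierC_eq_sum_add_pow_mul (by simpa using hb.abs) M x
  rw [hfun]
  refine ⟨hderiv.differentiableAt, ?_⟩
  refine (congrArg norm hderiv.deriv).trans_le ?_
  refine (norm_add_le _ _).trans (add_le_add ((norm_sum_le _ _).trans_eq ?_) ?_)
  · simp [mul_comm]
  · refine (norm_add_le _ _).trans ?_
    simp only [norm_mul, norm_pow, Circle.norm_coe, one_pow, norm_neg, Complex.norm_I, one_mul,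
      mul_one, Complex.norm_natCast]
    rw [add_mul]
    gcongr

end MonotoneCoefficients

section PowerDecay

theorem rpow_sub_one_le_div {s x : ℝ} (hs : s ≠ 0) (hs1 : s ≤ 1) (hx : 0 ≤ x)
    (h : x ≠ 0 ∨ 0 < s) : (x + 1) ^ (s - 1) ≤ ((x + 1) ^ s - x ^ s) / s := by
  obtain ⟨y, ⟨hxy, hyx⟩, hy⟩ := exists_hasDerivAt_eq_slope (fun t : ℝ => t ^ s / s)
    (fun t => t ^ (s - 1)) (lt_add_one x)
    (ContinuousOn.div_const (fun t ht => ContinuousAt.continuousWithinAt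
      (Real.continuousAt_rpow_const _ _ (h.imp (fun hx0 => by
        have := lt_of_le_of_ne hx hx0.symm
        exact (this.trans_le ht.1).ne') le_of_lt))) s)
    fun t ht => ((Real.hasDerivAt_rpow_const (Or.inl (hx.trans_lt ht.1).ne')).div_const
      s).congr_deriv (mul_div_cancel_left₀ _ hs)
  rw [add_sub_cancel_left, div_one, ← sub_div] at hy
  exact (Real.rpow_le_rpow_of_nonpos (hx.trans_lt hxy) hyx.le (by linarith)).trans_eq hy

theorem sum_range_rpow_sub_one_le {s : ℝ} (hs : s ≠ 0) (hs1 : s ≤ 1) {m : ℕ} (h : m ≠ 0 ∨ 0 < s)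
    (n : ℕ) :
    ∑ k ∈ Finset.range n, ((k + m + 1 : ℕ) : ℝ) ^ (s - 1) ≤
      (((n + m : ℕ) : ℝ) ^ s - (m : ℝ) ^ s) / s := by
  induction n with
  | zero => simp
  | succ n ih =>
    have hstep := rpow_sub_one_le_div (x := ((n + m : ℕ) : ℝ)) hs hs1 (by positivity)
      (h.imp (fun hm => by norm_cast; omega) id)
    rw [Finset.sum_range_succ, Nat.add_right_comm n 1 m]
    push_cast at *
    exact (add_le_add ih hstep).trans_eq (by ring)

theorem tsum_rpow_le {a : ℝ} (ha : 0 < a) {m : ℕ} (hm : m ≠ 0) :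
    ∑' k : ℕ, ((k + m + 1 : ℕ) : ℝ) ^ (-1 - a) ≤ (m : ℝ) ^ (-a) / a := by
  have hsum : Summable fun k : ℕ => ((k + (m + 1) : ℕ) : ℝ) ^ (-1 - a) :=
    (summable_nat_add_iff (m + 1)).2 (Real.summable_nat_rpow.2 (by linarith))
  refine hsum.tsum_le_of_sum_range_le fun n => ?_
  have h := sum_range_rpow_sub_one_le (s := -a) (by linarith) (by linarith) (Or.inl hm) n
  rw [div_neg, ← neg_div, neg_sub, show -a - 1 = -1 - a by ring] at h
  refine h.trans ?_
  gcongr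
  linarith [Real.rpow_nonneg (n + m : ℕ).cast_nonneg (-a)]

theorem sum_range_mul_abs_le {a C : ℝ} {b : ℕ → ℝ} (ha : 0 ≤ a) (ha1 : a < 1)
    (hb : ∀ k ≥ 1, |b k| ≤ C * (k : ℝ) ^ (-1 - a)) (M : ℕ) :
    ∑ k ∈ Finset.range (M + 1), (k : ℝ) * |b k| ≤ C * ((M : ℝ) ^ (1 - a) / (1 - a)) := by
  have hC : 0 ≤ C := by simpa using (abs_nonneg _).trans (hb 1 le_rfl)
  have hterm : ∀ k : ℕ, ((k + 1 : ℕ) : ℝ) * |b (k + 1)| ≤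
      C * ((k + 0 + 1 : ℕ) : ℝ) ^ (1 - a - 1) := by
    intro k
    refine (mul_le_mul_of_nonneg_left (hb (k + 1) (by omega)) (by positivity)).trans_eq ?_
    rw [mul_left_comm, show 1 - a - 1 = 1 + (-1 - a) by ring,
      Real.rpow_add (by positivity), Real.rpow_one, add_zero]
  rw [Finset.sum_range_succ', Nat.cast_zero, zero_mul, add_zero]
  refine (Finset.sum_le_sum fun k _ => hterm k).trans ?_
  rw [← Finset.mul_sum]
  have h := sum_range_rpow_sub_one_le (s := 1 - a) (m := 0) (by linarith) (by linarith)
    (Or.inr (by linarith)) M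
  rw [Nat.cast_zero, Real.zero_rpow (by linarith), sub_zero, add_zero] at h
  exact mul_le_mul_of_nonneg_left h hC

theorem summable_of_abs_le_rpow {a C : ℝ} {b : ℕ → ℝ} (ha : 0 < a)
    (hb : ∀ k ≥ 1, |b k| ≤ C * (k : ℝ) ^ (-1 - a)) : Summable b :=
  (summable_nat_add_iff 1).1 (.of_norm_bounded
    (((summable_nat_add_iff 1).2 (Real.summable_nat_rpow.2 (by linarith))).mul_left C)
    fun k => hb (k + 1) (by omega))

theorem tsum_add_le_of_abs_le_rpow {a C : ℝ} {b : ℕ → ℝ} (ha : 0 < a) {M : ℕ} (hM : M ≠ 0)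
    (hb : ∀ k ≥ 1, |b k| ≤ C * (k : ℝ) ^ (-1 - a)) :
    ∑' k, b (k + (M + 1)) ≤ C * ((M : ℝ) ^ (-a) / a) := by
  have hC : 0 ≤ C := by simpa using (abs_nonneg _).trans (hb 1 le_rfl)
  calc ∑' k, b (k + (M + 1)) ≤ ∑' k : ℕ, C * ((k + M + 1 : ℕ) : ℝ) ^ (-1 - a) :=
        Summable.tsum_le_tsum (fun k => (le_abs_self _).trans (hb (k + (M + 1)) (by omega)))
          ((summable_nat_add_iff (M + 1)).2 (summable_of_abs_le_rpow ha hb))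
          (((summable_nat_add_iff (M + 1)).2
            (Real.summable_nat_rpow.2 (by linarith))).mul_left C)
    _ ≤ C * ((M : ℝ) ^ (-a) / a) := by
        rw [tsum_mul_left]
        exact mul_le_mul_of_nonneg_left (tsum_rpow_le ha hM) hC

theorem exists_nat_one_le_abs_mul {ξ : ℝ} (hξ : |ξ| ≤ Real.pi) (hξ0 : ξ ≠ 0) :
    ∃ M : ℕ, 1 ≤ M * |ξ| ∧ M * |ξ| ≤ Real.pi := by
  have hpos := abs_pos.2 hξ0
  have hge : 1 ≤ Real.pi / |ξ| := (one_le_div hpos).2 hξ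
  refine ⟨⌊Real.pi / |ξ|⌋₊, ?_, ?_⟩
  · have h1 : (1 : ℝ) ≤ ⌊Real.pi / |ξ|⌋₊ := by exact_mod_cast (Nat.one_le_floor_iff _).2 hge
    have h2 := Nat.lt_floor_add_one (Real.pi / |ξ|)
    rw [div_lt_iff₀ hpos] at h2
    nlinarith [Real.pi_gt_three]
  · have h := Nat.floor_le (zero_le_one.trans hge)
    rwa [le_div_iff₀ hpos] at h

theorem rpow_one_sub_le_four_mul_rpow {a x y : ℝ} (ha : 0 ≤ a) (ha1 : a ≤ 1) (hx : 0 ≤ x)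
    (hy : 0 < y) (hxy : x * y ≤ 4) : x ^ (1 - a) ≤ 4 * y ^ (a - 1) := by
  calc x ^ (1 - a) ≤ (4 * y⁻¹) ^ (1 - a) := by
        refine Real.rpow_le_rpow hx ?_ (by linarith)
        rwa [← div_eq_mul_inv, le_div_iff₀ hy]
    _ = 4 ^ (1 - a) * y ^ (a - 1) := by
        rw [Real.mul_rpow (by norm_num) (by positivity), Real.inv_rpow hy.le,
          ← Real.rpow_neg hy.le, neg_sub]
    _ ≤ 4 * y ^ (a - 1) := by
        gcongr
        exact Real.rpow_le_self_of_one_le (by norm_num) (by linarith)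

theorem norm_deriv_fourierC_le_rpow {a C : ℝ} {b : ℕ → ℝ} (ha : 0 < a) (ha1 : a < 1)
    (hanti : AntitoneOn b (Set.Ici 1)) (hb : ∀ k ≥ 1, |b k| ≤ C * (k : ℝ) ^ (-1 - a)) {ξ : ℝ}
    (hξ : |ξ| ≤ Real.pi) (hξ0 : ξ ≠ 0) :
    DifferentiableAt ℝ (fourierC fun k => (b k : ℂ)) ξ ∧
      ‖deriv (fourierC fun k => (b k : ℂ)) ξ‖ ≤ C * (4 / (1 - a) + 12 / a) * |ξ| ^ (a - 1) := by
  have hC : 0 ≤ C := by simpa using (abs_nonneg _).trans (hb 1 le_rfl)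
  have hpos := abs_pos.2 hξ0
  have hsum := summable_of_abs_le_rpow ha hb
  obtain ⟨M, hM1, hMpi⟩ := exists_nat_one_le_abs_mul hξ hξ0
  have hM4 := hMpi.trans Real.pi_le_four
  have hM : M ≠ 0 := by rintro rfl; norm_num at hM1
  have hMpos : (1 : ℝ) ≤ M := by exact_mod_cast Nat.one_le_iff_ne_zero.2 hM
  obtain ⟨hdiff, hle⟩ := norm_deriv_fourierC_le_of_antitoneOn (M := M + 1) hsum
    (hanti.mono (Set.Ici_subset_Ici.2 (by omega))) hξ hξ0
  refine ⟨hdiff, hle.trans ?_⟩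
  have hhead : (M : ℝ) ^ (1 - a) ≤ 4 * |ξ| ^ (a - 1) :=
    rpow_one_sub_le_four_mul_rpow ha.le ha1.le M.cast_nonneg hpos hM4
  have htail : (M : ℝ) ^ (-a) ≤ |ξ| ^ a := by
    rw [Real.rpow_neg M.cast_nonneg, ← Real.inv_rpow M.cast_nonneg]
    refine Real.rpow_le_rpow (by positivity) ?_ ha.le
    rwa [inv_le_iff_one_le_mul₀' (by positivity)]
  have hcoef : ((M + 1 : ℕ) : ℝ) + 4 / |ξ| ≤ 12 / |ξ| := by
    rw [← le_sub_iff_add_le, ← sub_div, le_div_iff₀ hpos]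
    push_cast
    nlinarith
  calc _ ≤ C * (4 * |ξ| ^ (a - 1) / (1 - a)) + 12 / |ξ| * (C * (|ξ| ^ a / a)) := by
        refine add_le_add ((sum_range_mul_abs_le ha.le ha1 hb M).trans ?_) ?_
        · gcongr
        · exact (mul_le_mul_of_nonneg_left (tsum_add_le_of_abs_le_rpow ha hM hb)
            (by positivity)).trans (by gcongr)
    _ = C * (4 / (1 - a) + 12 / a) * |ξ| ^ (a - 1) := by
        rw [Real.rpow_sub_one hpos.ne']
        ring

end PowerDecay

section Criterion

variable {F b : ℕ → ℝ} {a c C ξ : ℝ}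

theorem one_le_pi_mul_rpow_sub_one (ha : a ≤ 1) (ha0 : 0 ≤ a) (hξ : |ξ| ≤ Real.pi) (hξ0 : ξ ≠ 0) :
    1 ≤ Real.pi * |ξ| ^ (a - 1) := by
  have hpi : 1 ≤ Real.pi := by linarith [Real.pi_gt_three]
  calc (1 : ℝ) ≤ Real.pi ^ a := Real.one_le_rpow hpi ha0
    _ = Real.pi * Real.pi ^ (a - 1) := by
        rw [Real.rpow_sub_one Real.pi_ne_zero, mul_div_cancel₀ _ Real.pi_ne_zero]
    _ ≤ Real.pi * |ξ| ^ (a - 1) := by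
        gcongr 1
        exact Real.rpow_le_rpow_of_nonpos (abs_pos.2 hξ0) hξ (by linarith)

theorem norm_deriv_fourierZ_le_rpow (ha : 0 < a) (ha1 : a < 1)
    (hanti : AntitoneOn b (Set.Ici 1)) (hb : ∀ k ≥ 1, |b k| ≤ C * (k : ℝ) ^ (-1 - a))
    (hFb : Summable fun k : ℕ => (k : ℝ) * |F k - b k|) (hξ : |ξ| ≤ Real.pi) (hξ0 : ξ ≠ 0) :
    DifferentiableAt ℝ (fourierZ F) ξ ∧ ‖deriv (fourierZ F) ξ‖ ≤
      (C * (4 / (1 - a) + 12 / a) + Real.pi * ∑' k : ℕ, (k : ℝ) * |F k - b k|) *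
        |ξ| ^ (a - 1) := by
  have hnorm : ∀ k, ‖(F k : ℂ) - b k‖ = |F k - b k| := fun k => by
    rw [← Complex.ofReal_sub, Complex.norm_real, Real.norm_eq_abs]
  have hmoment : Summable fun k : ℕ => (k : ℝ) * ‖(F k : ℂ) - b k‖ := by simpa only [hnorm]
  have hbs : Summable fun k => ‖(b k : ℂ)‖ := by simpa using (summable_of_abs_le_rpow ha hb).abs
  have hFs : Summable fun k => ‖(F k : ℂ)‖ := by
    simpa only [sub_add_cancel] using
      ((summable_norm_of_summable_nat_mul hmoment).of_norm.add hbs.of_norm).norm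
  have hsplit : fourierZ F =
      (fourierC fun k => (b k : ℂ)) + fourierC fun k => (F k : ℂ) - b k := by
    ext x
    change _ = _ + fourierC ((fun k => (F k : ℂ)) - fun k => (b k : ℂ)) x
    rw [fourierC_sub hFs hbs, fourierZ_eq_fourierC, add_sub_cancel]
  obtain ⟨hdiff, hle⟩ := norm_deriv_fourierC_le_rpow ha ha1 hanti hb hξ hξ0
  have hdiff' := (hasDerivAt_fourierC hmoment ξ).differentiableAt
  have hle' := norm_deriv_fourierC_le hmoment ξ
  simp only [hnorm] at hle'
  have hB : 0 ≤ ∑' k : ℕ, (k : ℝ) * |F k - b k| := tsum_nonneg fun k => by positivity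
  rw [hsplit, deriv_add hdiff hdiff']
  refine ⟨hdiff.add hdiff', (norm_add_le _ _).trans ?_⟩
  nlinarith [mul_le_mul_of_nonneg_left (one_le_pi_mul_rpow_sub_one ha1.le ha.le hξ hξ0) hB]

theorem summable_mul_one_sub_cos {f : ℕ → ℝ} (hf : Summable f) (ξ : ℝ) :
    Summable fun k : ℕ => f k * (1 - Real.cos (k * ξ)) := by
  refine .of_norm_bounded (hf.abs.mul_right 2) fun k => ?_
  rw [norm_mul, Real.norm_eq_abs, Real.norm_of_nonneg (by linarith [Real.cos_le_one (k * ξ)])]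
  gcongr
  linarith [Real.neg_one_le_cos (k * ξ)]

theorem one_sub_re_fourierZ (hF : IsProbability F) (ξ : ℝ) :
    1 - (fourierZ F ξ).re = ∑' k : ℕ, F k * (1 - Real.cos (k * ξ)) := by
  have hs : Summable fun k => ‖(F k : ℂ)‖ := by simpa using hF.hasSum.summable.abs
  have hre := Complex.hasSum_re (summable_mul_circle_pow hs (Circle.exp (-ξ))).hasSum
  rw [fourierZ_eq_fourierC, fourierC, ← (hF.hasSum.sub hre).tsum_eq]
  refine tsum_congr fun k => ?_
  rw [Complex.re_ofReal_mul, ← Circle.coe_pow, ← Circle.exp_nsmul, Circle.coe_exp,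
    Complex.exp_ofReal_mul_I_re, nsmul_eq_mul, mul_neg, Real.cos_neg]
  ring

theorem one_sub_cos_le_abs (x : ℝ) : 1 - Real.cos x ≤ |x| := by
  rcases le_total |x| 2 with h | h
  · nlinarith [Real.one_sub_sq_div_two_le_cos (x := x), abs_nonneg x, sq_abs x]
  · linarith [Real.neg_one_le_cos x]

theorem pow_three_le_three_mul_sum_range_sq (n : ℕ) :
    (n : ℝ) ^ 3 ≤ 3 * ∑ k ∈ Finset.range (n + 1), (k : ℝ) ^ 2 := by
  induction n with
  | zero => simp
  | succ n ih =>
    rw [Finset.sum_range_succ]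
    push_cast
    nlinarith [n.cast_nonneg (α := ℝ)]

theorem two_div_pi_sq_mul_le_tsum_one_sub_cos (ha : 0 < a) {M : ℕ}
    (hM : M * |ξ| ≤ Real.pi) :
    2 / Real.pi ^ 2 * ξ ^ 2 * ((M : ℝ) ^ (-1 - a) * (M ^ 3 / 3)) ≤
      ∑' k : ℕ, (k : ℝ) ^ (-1 - a) * (1 - Real.cos (k * ξ)) := by
  have hterm : ∀ k ∈ Finset.range (M + 1), 2 / Real.pi ^ 2 * ξ ^ 2 * ((M : ℝ) ^ (-1 - a) * k ^ 2) ≤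
      (k : ℝ) ^ (-1 - a) * (1 - Real.cos (k * ξ)) := by
    intro k hk
    rcases Nat.eq_zero_or_pos k with rfl | hk0
    · simp
    have hkM : (k : ℝ) ≤ M := by exact_mod_cast Nat.lt_succ_iff.1 (Finset.mem_range.1 hk)
    have hkpi : |k * ξ| ≤ Real.pi := by
      rw [abs_mul, Nat.abs_cast]
      exact (mul_le_mul_of_nonneg_right hkM (abs_nonneg ξ)).trans hM
    have hcos := Real.cos_le_one_sub_mul_cos_sq hkpi
    have hpow : (M : ℝ) ^ (-1 - a) ≤ (k : ℝ) ^ (-1 - a) :=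
      Real.rpow_le_rpow_of_nonpos (by exact_mod_cast hk0) hkM (by linarith)
    calc 2 / Real.pi ^ 2 * ξ ^ 2 * ((M : ℝ) ^ (-1 - a) * k ^ 2)
        = (M : ℝ) ^ (-1 - a) * (2 / Real.pi ^ 2 * (k * ξ) ^ 2) := by ring
      _ ≤ (k : ℝ) ^ (-1 - a) * (1 - Real.cos (k * ξ)) := by gcongr; linarith
  refine le_trans ?_ ((summable_mul_one_sub_cos
    (Real.summable_nat_rpow.2 (by linarith : -1 - a < -1)) ξ).sum_le_tsum (Finset.range (M + 1))
    fun k _ => mul_nonneg (by positivity) (by linarith [Real.cos_le_one (k * ξ)]))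
  refine le_trans ?_ (Finset.sum_le_sum hterm)
  rw [← Finset.mul_sum, ← Finset.mul_sum]
  gcongr
  linarith [pow_three_le_three_mul_sum_range_sq M]

theorem rpow_div_le_tsum_one_sub_cos (ha : 0 < a) (ha2 : a ≤ 2) (hξ : |ξ| ≤ Real.pi) :
    |ξ| ^ a / 24 ≤ ∑' k : ℕ, (k : ℝ) ^ (-1 - a) * (1 - Real.cos (k * ξ)) := by
  rcases eq_or_ne ξ 0 with rfl | hξ0
  · simp [Real.zero_rpow ha.ne']
  have hpos := abs_pos.2 hξ0
  obtain ⟨M, hM1, hMpi⟩ := exists_nat_one_le_abs_mul hξ hξ0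
  refine le_trans ?_ (two_div_pi_sq_mul_le_tsum_one_sub_cos ha hMpi)
  have hM : (0 : ℝ) < M := by
    by_contra! h
    nlinarith
  have hpow : (M : ℝ) ^ (-1 - a) * M ^ 3 = (M : ℝ) ^ (2 - a) := by
    rw [← Real.rpow_natCast, ← Real.rpow_add hM]
    norm_num
    ring_nf
  have hge : |ξ| ^ a ≤ ξ ^ 2 * (M : ℝ) ^ (2 - a) := by
    calc |ξ| ^ a ≤ |ξ| ^ a * (M * |ξ|) ^ (2 - a) :=
          le_mul_of_one_le_right (by positivity) (Real.one_le_rpow hM1 (by linarith))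
      _ = |ξ| ^ (a + (2 - a)) * (M : ℝ) ^ (2 - a) := by
          rw [Real.mul_rpow hM.le hpos.le, Real.rpow_add hpos]
          ring
      _ = ξ ^ 2 * (M : ℝ) ^ (2 - a) := by
          rw [add_sub_cancel, Real.rpow_two, sq_abs]
  have hpi : 1 / 8 ≤ 2 / Real.pi ^ 2 := by
    rw [div_le_div_iff₀ (by norm_num) (by positivity)]
    nlinarith [Real.pi_le_four, Real.pi_pos]
  calc |ξ| ^ a / 24 = 1 / 8 * |ξ| ^ a / 3 := by ring
    _ ≤ 2 / Real.pi ^ 2 * (ξ ^ 2 * (M : ℝ) ^ (2 - a)) / 3 := by gcongr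
    _ = 2 / Real.pi ^ 2 * ξ ^ 2 * ((M : ℝ) ^ (-1 - a) * (M ^ 3 / 3)) := by
        rw [← hpow]
        ring

theorem mul_tsum_one_sub_cos_le (hF : IsProbability F) (ha : 0 < a) {e : ℕ → ℝ}
    (he : Summable fun k : ℕ => (k : ℝ) * |e k|)
    (hlow : ∀ k : ℕ, c * (k : ℝ) ^ (-1 - a) ≤ F k + |e k|) (ξ : ℝ) :
    c * ∑' k : ℕ, (k : ℝ) ^ (-1 - a) * (1 - Real.cos (k * ξ)) ≤
      1 - (fourierZ F ξ).re + (∑' k : ℕ, (k : ℝ) * |e k|) * |ξ| := by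
  have hcos : ∀ k : ℕ, 0 ≤ 1 - Real.cos (k * ξ) := fun k => by linarith [Real.cos_le_one (k * ξ)]
  have hp := summable_mul_one_sub_cos (Real.summable_nat_rpow.2 (by linarith : -1 - a < -1)) ξ
  have hFs := summable_mul_one_sub_cos hF.hasSum.summable ξ
  rw [one_sub_re_fourierZ hF, ← tsum_mul_left, ← tsum_mul_right, ← hFs.tsum_add (he.mul_right _)]
  refine (hp.mul_left c).tsum_le_tsum (fun k => ?_) (hFs.add (he.mul_right _))
  calc c * ((k : ℝ) ^ (-1 - a) * (1 - Real.cos (k * ξ)))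
      = c * (k : ℝ) ^ (-1 - a) * (1 - Real.cos (k * ξ)) := by ring
    _ ≤ (F k + |e k|) * (1 - Real.cos (k * ξ)) := mul_le_mul_of_nonneg_right (hlow k) (hcos k)
    _ = F k * (1 - Real.cos (k * ξ)) + |e k| * (1 - Real.cos (k * ξ)) := add_mul _ _ _
    _ ≤ F k * (1 - Real.cos (k * ξ)) + |e k| * |k * ξ| := by
        gcongr
        exact one_sub_cos_le_abs _
    _ = F k * (1 - Real.cos (k * ξ)) + k * |e k| * |ξ| := by
        rw [abs_mul, Nat.abs_cast]
        ring

theorem exists_mul_abs_le_mul_rpow (ha1 : a < 1) (hc : 0 < c) (B : ℝ) :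
    ∃ δ > 0, ∀ ξ : ℝ, |ξ| ≤ δ → B * |ξ| ≤ c * |ξ| ^ a := by
  have hlim : Filter.Tendsto (fun x : ℝ => B * |x| ^ (1 - a)) (nhds 0) (nhds 0) := by
    have h : ContinuousAt (fun x : ℝ => B * |x| ^ (1 - a)) 0 :=
      ((Real.continuousAt_rpow_const _ _ (.inr (by linarith))).comp
        continuous_abs.continuousAt).const_mul B
    simpa [ContinuousAt, Real.zero_rpow (sub_pos.2 ha1).ne'] using h
  obtain ⟨δ, hδ, hle⟩ := Metric.nhds_basis_closedBall.eventually_iff.1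
    (hlim.eventually_lt_const hc)
  refine ⟨δ, hδ, fun ξ hξ => ?_⟩
  rcases eq_or_ne ξ 0 with rfl | hξ0
  · simp only [abs_zero, mul_zero]
    positivity
  calc B * |ξ| = B * |ξ| ^ (1 - a) * |ξ| ^ a := by
        rw [mul_assoc, ← Real.rpow_add (abs_pos.2 hξ0), sub_add_cancel, Real.rpow_one]
    _ ≤ c * |ξ| ^ a := by
        gcongr
        exact (hle (by simpa using hξ)).le

theorem exists_le_one_sub_re_fourierZ (hF : IsProbability F) (ha : 0 < a) (ha1 : a < 1)
    (hc : 0 < c) {e : ℕ → ℝ} (he : Summable fun k : ℕ => (k : ℝ) * |e k|)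
    (hlow : ∀ k : ℕ, c * (k : ℝ) ^ (-1 - a) ≤ F k + |e k|) :
    ∃ ε : ℝ, 0 < ε ∧ ε < 1 ∧ ∀ ξ ∈ Set.Icc (-ε) ε, ε * |ξ| ^ a ≤ 1 - (fourierZ F ξ).re := by
  obtain ⟨δ, hδ, hsmall⟩ := exists_mul_abs_le_mul_rpow ha1 (by positivity : 0 < c / 48)
    (∑' k : ℕ, (k : ℝ) * |e k|)
  refine ⟨min (1 / 2) (min (c / 48) δ), by positivity,
    (min_le_left _ _).trans_lt (by norm_num), fun ξ hξ => ?_⟩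
  obtain ⟨hhalf, -, hξδ⟩ := by simpa only [le_min_iff] using abs_le.2 hξ
  have hmain := rpow_div_le_tsum_one_sub_cos ha (by linarith)
    (hhalf.trans (by linarith [Real.pi_gt_three]))
  have herr := mul_tsum_one_sub_cos_le hF ha he hlow ξ
  calc min (1 / 2) (min (c / 48) δ) * |ξ| ^ a ≤ c / 48 * |ξ| ^ a := by
        gcongr
        exact (min_le_right _ _).trans (min_le_left _ _)
    _ ≤ 1 - (fourierZ F ξ).re := by linarith [hsmall ξ hξδ, mul_le_mul_of_nonneg_left hmain hc.le]

theorem exists_consecutive_ne_zero {e g : ℕ → ℝ} (hanti : AntitoneOn g (Set.Ici 1))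
    (hg : ¬ Summable g) (hg0 : ∀ k ≥ 1, 0 ≤ g k) (he : Summable e) (he0 : ∀ k, 0 ≤ e k)
    (hge : ∀ k ≥ 1, F k = 0 → g k ≤ e k) : ∃ k, F k ≠ 0 ∧ F (k + 1) ≠ 0 := by
  by_contra! hzero
  refine hg ((summable_nat_add_iff 2).1 (.of_nonneg_of_le (fun k => hg0 _ (by omega)) (fun k => ?_)
    (((summable_nat_add_iff 1).2 he).add ((summable_nat_add_iff 2).2 he))))
  by_cases h : F (k + 1) = 0
  · calc g (k + 2) ≤ g (k + 1) := hanti (by simp) (by simp) (by omega)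
      _ ≤ e (k + 1) := hge _ (by omega) h
      _ ≤ e (k + 1) + e (k + 2) := le_add_of_nonneg_right (he0 _)
  · exact (hge _ (by omega) (hzero _ h)).trans (le_add_of_nonneg_left (he0 _))

theorem isAperiodic_of_consecutive_ne_zero {k : ℕ} (hk : F k ≠ 0) (hk' : F (k + 1) ≠ 0) :
    IsAperiodic F := by
  intro m
  have hmem := AddSubgroup.subset_closure
    (show m + (k : ℤ) ∈ translateSupport F m from ⟨k, hk, rfl⟩)
  have hmem' := AddSubgroup.subset_closure
    (show m + ((k + 1 : ℕ) : ℤ) ∈ translateSupport F m from ⟨k + 1, hk', rfl⟩)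
  have hone : (1 : ℤ) ∈ AddSubgroup.closure (translateSupport F m) := by
    convert sub_mem hmem' hmem using 1
    push_cast
    ring
  exact (AddSubgroup.eq_top_iff' _).2 fun x => by simpa using zsmul_mem hone x

theorem isAperiodic_of_rpow_le (ha : 0 < a) (ha1 : a ≤ 1) (hc : 0 < c) {e : ℕ → ℝ}
    (he : Summable fun k : ℕ => (k : ℝ) * |e k|)
    (hlow : ∀ k : ℕ, c * (k : ℝ) ^ (-1 - a) ≤ F k + |e k|) : IsAperiodic F := by
  have hanti : AntitoneOn (fun k : ℕ => c * (k : ℝ) ^ (-a)) (Set.Ici 1) := fun i hi j _ hij =>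
    mul_le_mul_of_nonneg_left (Real.rpow_le_rpow_of_nonpos
      (by exact_mod_cast Nat.lt_of_lt_of_le one_pos hi) (by exact_mod_cast hij) (by linarith)) hc.le
  have hnot : ¬ Summable fun k : ℕ => c * (k : ℝ) ^ (-a) := by
    rw [summable_mul_left_iff hc.ne', Real.summable_nat_rpow]
    linarith
  obtain ⟨k, hk, hk'⟩ := exists_consecutive_ne_zero (F := F) hanti hnot (fun k _ => by positivity)
    he (fun k => by positivity) fun k hk h0 => by
      have hk0 : (k : ℝ) ≠ 0 := by exact_mod_cast Nat.one_le_iff_ne_zero.1 hk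
      calc c * (k : ℝ) ^ (-a) = k * (c * (k : ℝ) ^ (-1 - a)) := by
            rw [show -1 - a = -a - 1 by ring, Real.rpow_sub_one hk0]
            field_simp
        _ ≤ k * |e k| := by
            gcongr
            simpa only [h0, zero_add] using hlow k
  exact isAperiodic_of_consecutive_ne_zero hk hk'

theorem fourierCriterion_of_antitoneOn (hF : IsProbability F) (ha : 0 < a) (ha1 : a < 1)
    (hc : 0 < c) (hanti : AntitoneOn b (Set.Ici 1))
    (hlow : ∀ k : ℕ, 1 ≤ k → c * (k : ℝ) ^ (-1 - a) ≤ b k)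
    (hup : ∀ k : ℕ, 1 ≤ k → b k ≤ C * (k : ℝ) ^ (-1 - a))
    (hFb : Summable fun k : ℕ => (k : ℝ) * |F k - b k|) : FourierCriterion a F := by
  have hFlow : ∀ k : ℕ, c * (k : ℝ) ^ (-1 - a) ≤ F k + |F k - b k| := by
    intro k
    rcases Nat.eq_zero_or_pos k with rfl | hk
    · rw [Nat.cast_zero, Real.zero_rpow (by linarith), mul_zero]
      exact add_nonneg (hF.nonneg 0) (abs_nonneg _)
    · linarith [hlow k hk, neg_abs_le (F k - b k)]
  have hb : ∀ k ≥ 1, |b k| ≤ C * (k : ℝ) ^ (-1 - a) := fun k hk => by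
    rw [abs_of_nonneg ((by positivity : 0 ≤ c * (k : ℝ) ^ (-1 - a)).trans (hlow k hk))]
    exact hup k hk
  obtain ⟨ε, hε, hε1, hre⟩ := exists_le_one_sub_re_fourierZ hF ha ha1 hc hFb hFlow
  refine ⟨hF, isAperiodic_of_rpow_le ha ha1.le hc hFb hFlow, ε, hε, hε1,
    max 1 (C * (4 / (1 - a) + 12 / a) + Real.pi * ∑' k : ℕ, (k : ℝ) * |F k - b k|),
    lt_max_of_lt_left one_pos, hre, fun ξ hξ hξ0 => ?_⟩
  obtain ⟨hdiff, hle⟩ := norm_deriv_fourierZ_le_rpow ha ha1 hanti hb hFb (abs_le.2 hξ) hξ0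
  exact ⟨hdiff, hle.trans (mul_le_mul_of_nonneg_right (le_max_right _ _) (by positivity))⟩

end Criterion

section PowerBound

/-- `φ` has a singularity of order at most `b` at the origin of the period `[-π, π]`:
`|φ(ξ)| ≤ A |ξ|^b`, and `|φ'(ξ)| ≤ A |ξ|^{b - 1}` off the origin. -/
structure PowerBound (φ : ℝ → ℂ) (A b : ℝ) : Prop where
  norm_le : ∀ ξ, |ξ| ≤ Real.pi → ‖φ ξ‖ ≤ A * |ξ| ^ b
  differentiableAt : ∀ ξ, |ξ| ≤ Real.pi → ξ ≠ 0 → DifferentiableAt ℝ φ ξ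
  norm_deriv_le : ∀ ξ, |ξ| ≤ Real.pi → ξ ≠ 0 → ‖deriv φ ξ‖ ≤ A * |ξ| ^ (b - 1)

variable {φ : ℝ → ℂ} {A a b D ξ : ℝ}

theorem PowerBound.nonneg (h : PowerBound φ A b) : 0 ≤ A := by
  have hpi := h.norm_le Real.pi (abs_of_pos Real.pi_pos).le
  rw [abs_of_pos Real.pi_pos] at hpi
  exact nonneg_of_mul_nonneg_left ((norm_nonneg _).trans hpi) (by positivity)

theorem norm_sub_zero_le_rpow_of_pos (hφ : Continuous φ) (ha : 0 < a) (hξ : 0 ≤ ξ)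
    (hdiff : ∀ t ∈ Set.Ioc 0 ξ, DifferentiableAt ℝ φ t)
    (hderiv : ∀ t ∈ Set.Ioc 0 ξ, ‖deriv φ t‖ ≤ D * t ^ (a - 1)) :
    ‖φ ξ - φ 0‖ ≤ D / a * ξ ^ a := by
  have hpow : IntervalIntegrable (fun t => D * t ^ (a - 1)) MeasureTheory.volume 0 ξ :=
    (intervalIntegral.intervalIntegrable_rpow' (by linarith)).const_mul D
  have hint : IntervalIntegrable (deriv φ) MeasureTheory.volume 0 ξ := by
    refine hpow.mono_fun (stronglyMeasurable_deriv φ).aestronglyMeasurable ?_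
    rw [Set.uIoc_of_le hξ]
    filter_upwards [MeasureTheory.ae_restrict_mem measurableSet_Ioc] with t ht
    exact (hderiv t ht).trans (le_abs_self _)
  calc ‖φ ξ - φ 0‖ = ‖∫ t in (0 : ℝ)..ξ, deriv φ t‖ := by
        rw [intervalIntegral.integral_eq_sub_of_hasDerivAt_of_le hξ hφ.continuousOn
          (fun t ht => (hdiff t (Set.Ioo_subset_Ioc_self ht)).hasDerivAt) hint]
    _ ≤ ∫ t in (0 : ℝ)..ξ, D * t ^ (a - 1) :=
        intervalIntegral.norm_integral_le_of_norm_le hξ (.of_forall hderiv) hpow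
    _ = D / a * ξ ^ a := by
        rw [intervalIntegral.integral_const_mul, integral_rpow (Or.inl (by linarith)),
          sub_add_cancel, Real.zero_rpow ha.ne', sub_zero]
        ring

theorem powerBound_of_norm_deriv_le (hφ : Continuous φ) (h0 : φ 0 = 0) (ha : 0 < a) (ha1 : a ≤ 1)
    (hdiff : ∀ ξ, |ξ| ≤ Real.pi → ξ ≠ 0 → DifferentiableAt ℝ φ ξ)
    (hderiv : ∀ ξ, |ξ| ≤ Real.pi → ξ ≠ 0 → ‖deriv φ ξ‖ ≤ D * |ξ| ^ (a - 1)) :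
    PowerBound φ (D / a) a where
  norm_le ξ hξ := by
    have habs : ∀ t ∈ Set.Ioc 0 |ξ|, |t| ≤ Real.pi ∧ |-t| ≤ Real.pi := fun t ht => by
      rw [abs_neg, abs_of_pos ht.1]
      exact ⟨ht.2.trans hξ, ht.2.trans hξ⟩
    rcases le_total 0 ξ with hpos | hneg
    · rw [abs_of_nonneg hpos] at habs ⊢
      simpa only [h0, sub_zero] using norm_sub_zero_le_rpow_of_pos hφ ha hpos
        (fun t ht => hdiff t (habs t ht).1 ht.1.ne')
        (fun t ht => by simpa only [abs_of_pos ht.1] using hderiv t (habs t ht).1 ht.1.ne')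
    · rw [abs_of_nonpos hneg] at habs ⊢
      have h := norm_sub_zero_le_rpow_of_pos (φ := fun t => φ (-t)) (D := D)
        (hφ.comp continuous_neg) ha (neg_nonneg.2 hneg)
        (fun t ht => ((hdiff (-t) (habs t ht).2 (neg_ne_zero.2 ht.1.ne')).comp t
          differentiableAt_id.neg))
        (fun t ht => by
          rw [deriv_comp_neg, norm_neg]
          simpa only [abs_neg, abs_of_pos ht.1] using
            hderiv (-t) (habs t ht).2 (neg_ne_zero.2 ht.1.ne'))
      simpa only [neg_neg, neg_zero, h0, sub_zero] using h
  differentiableAt := hdiff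
  norm_deriv_le ξ hξ hξ0 := by
    have hpi : 0 ≤ D := nonneg_of_mul_nonneg_left
      ((norm_nonneg _).trans (hderiv ξ hξ hξ0)) (by positivity)
    refine (hderiv ξ hξ hξ0).trans ?_
    gcongr
    exact le_div_self hpi ha ha1

end PowerBound

section Decay

variable {F : ℕ → ℝ} {a ξ : ℝ}

theorem fourierZ_zero (hF : IsProbability F) : fourierZ F 0 = 1 := by
  simpa [fourierZ] using (Complex.hasSum_ofReal.2 hF.hasSum).tsum_eq

theorem continuous_fourierZ (hF : Summable fun k => ‖F k‖) : Continuous (fourierZ F) := by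
  rw [fourierZ_eq_fourierC]
  exact continuous_fourierC (by simpa only [Complex.norm_real] using hF)

theorem hasSum_mul_norm_pow_sub_fourierZ_sq (hF : IsProbability F) (ξ : ℝ) :
    HasSum (fun k => F k * ‖(Circle.exp (-ξ) : ℂ) ^ k - fourierZ F ξ‖ ^ 2)
      (1 - ‖fourierZ F ξ‖ ^ 2) := by
  set z := Circle.exp (-ξ)
  set v := fourierZ F ξ with hv
  have hs : Summable fun k => ‖(F k : ℂ)‖ := by simpa using hF.hasSum.summable.abs
  have hsum : HasSum (fun k => (F k : ℂ) * (z : ℂ) ^ k) v := by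
    rw [hv, fourierZ_eq_fourierC]
    exact (summable_mul_circle_pow hs z).hasSum
  have hre := Complex.hasSum_re (hsum.mul_right ((starRingEnd ℂ) v))
  have h := (hF.hasSum.mul_right (1 + ‖v‖ ^ 2)).sub (hre.mul_left 2)
  have hterm : ∀ k, F k * ‖(z : ℂ) ^ k - v‖ ^ 2 =
      F k * (1 + ‖v‖ ^ 2) - 2 * ((F k : ℂ) * (z : ℂ) ^ k * (starRingEnd ℂ) v).re := fun k => by
    rw [← Complex.normSq_eq_norm_sq, Complex.normSq_sub, Complex.normSq_eq_norm_sq,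
      Complex.normSq_eq_norm_sq, norm_pow, Circle.norm_coe, mul_assoc, Complex.re_ofReal_mul]
    ring
  have hval : 1 - ‖v‖ ^ 2 = 1 * (1 + ‖v‖ ^ 2) - 2 * (v * (starRingEnd ℂ) v).re := by
    rw [Complex.mul_conj', ← Complex.ofReal_pow, Complex.ofReal_re]
    ring
  simpa only [hterm, hval] using h

theorem IsAperiodic.eq_one_of_pow_eq (hF : IsAperiodic F) {k₀ : ℕ} {z : Circle}
    (hz : ∀ k, F k ≠ 0 → z ^ k = z ^ k₀) : z = 1 := by
  have hclosure : ∀ x ∈ AddSubgroup.closure (translateSupport F (-k₀)), z ^ x = 1 := fun x hx => by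
    induction hx using AddSubgroup.closure_induction with
    | mem x hx =>
      obtain ⟨k, hk, rfl⟩ := hx
      rw [zpow_add, zpow_neg, zpow_natCast, zpow_natCast, hz k hk, inv_mul_cancel]
    | zero => rw [zpow_zero]
    | add x y _ _ hx hy => rw [zpow_add, hx, hy, one_mul]
    | neg x _ hx => rw [zpow_neg, hx, inv_one]
  simpa only [zpow_one] using hclosure 1 (by simp only [hF (-k₀), AddSubgroup.mem_top])

theorem norm_fourierZ_lt_one (hF : IsProbability F) (haper : IsAperiodic F) (hξ : |ξ| ≤ Real.pi)
    (hξ0 : ξ ≠ 0) : ‖fourierZ F ξ‖ < 1 := by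
  by_contra! hle
  have hnonneg : ∀ k, 0 ≤ F k * ‖(Circle.exp (-ξ) : ℂ) ^ k - fourierZ F ξ‖ ^ 2 := fun k =>
    mul_nonneg (hF.nonneg k) (sq_nonneg _)
  have hpow : ∀ k, F k ≠ 0 → (Circle.exp (-ξ) : ℂ) ^ k = fourierZ F ξ := fun k hk => by
    have hterm := le_hasSum (hasSum_mul_norm_pow_sub_fourierZ_sq hF ξ) k fun j _ => hnonneg j
    have hzero := le_antisymm (hterm.trans (sub_nonpos.2 (one_le_pow₀ hle))) (hnonneg k)
    rw [mul_eq_zero, or_iff_right hk, sq_eq_zero_iff, norm_sub_eq_zero_iff] at hzero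
    exact hzero
  obtain ⟨k₀, hk₀⟩ : ∃ k, F k ≠ 0 := by
    by_contra! hzero
    exact one_ne_zero (hF.hasSum.unique (funext hzero ▸ hasSum_zero))
  have hz : Circle.exp (-ξ) = 1 := haper.eq_one_of_pow_eq (k₀ := k₀) fun k hk => Circle.ext <| by
    rw [Circle.coe_pow, Circle.coe_pow, hpow k hk, hpow k₀ hk₀]
  have hbound := abs_le_two_mul_norm_one_sub_circle_exp_neg hξ
  rw [hz, Circle.coe_one, sub_self, norm_zero, mul_zero] at hbound
  exact hξ0 (abs_nonpos_iff.1 hbound)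

theorem norm_le_exp_of_le_one_sub_re {z : ℂ} {t : ℝ} (hre : t ≤ 1 - z.re)
    (hnorm : ‖1 - z‖ ^ 2 ≤ t) : ‖z‖ ≤ Real.exp (-(t / 2)) := by
  refine le_of_sq_le_sq ?_ (Real.exp_nonneg _)
  have hexpand : ‖z‖ ^ 2 = 1 - 2 * (1 - z.re) + ‖1 - z‖ ^ 2 := by
    rw [Complex.sq_norm, Complex.sq_norm, Complex.normSq_sub]
    simp only [map_one, one_mul, Complex.conj_re]
    ring
  calc ‖z‖ ^ 2 ≤ -t + 1 := by linarith
    _ ≤ Real.exp (-t) := Real.add_one_le_exp _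
    _ = Real.exp (-(t / 2)) ^ 2 := by rw [← Real.exp_nat_mul]; ring_nf

theorem exists_norm_fourierZ_le_exp_near_zero {C ε : ℝ} (ha : 0 < a) (hε : 0 < ε)
    (hre : ∀ ξ, |ξ| ≤ ε → ε * |ξ| ^ a ≤ 1 - (fourierZ F ξ).re)
    (hC : ∀ ξ, |ξ| ≤ Real.pi → ‖1 - fourierZ F ξ‖ ≤ C * |ξ| ^ a) :
    ∃ δ > 0, ∀ ξ, |ξ| ≤ δ → ‖fourierZ F ξ‖ ≤ Real.exp (-(ε / 2 * |ξ| ^ a)) := by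
  have hlim : ∀ᶠ ξ in nhds (0 : ℝ), C ^ 2 * |ξ| ^ a < ε := by
    have hcont : ContinuousAt (fun ξ : ℝ => C ^ 2 * |ξ| ^ a) 0 :=
      (continuous_abs.continuousAt.rpow_const (Or.inr ha.le)).const_mul _
    refine hcont.eventually_lt_const ?_
    simpa [Real.zero_rpow ha.ne'] using hε
  have hsmall : ∀ᶠ ξ in nhds (0 : ℝ), |ξ| < min ε Real.pi :=
    continuous_abs.continuousAt.eventually_lt_const (by simpa using ⟨hε, Real.pi_pos⟩)
  obtain ⟨δ, hδ, hball⟩ :=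
    Metric.nhds_basis_closedBall.eventually_iff.1 (hlim.and hsmall)
  refine ⟨δ, hδ, fun ξ hξ => ?_⟩
  obtain ⟨hlt, hmin⟩ := hball (by simpa [Metric.mem_closedBall] using hξ)
  rw [← mul_div_right_comm]
  refine norm_le_exp_of_le_one_sub_re (hre ξ (hmin.le.trans (min_le_left _ _))) ?_
  calc ‖1 - fourierZ F ξ‖ ^ 2 ≤ (C * |ξ| ^ a) ^ 2 := by
        gcongr
        exact hC ξ (hmin.le.trans (min_le_right _ _))
    _ = C ^ 2 * |ξ| ^ a * |ξ| ^ a := by ring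
    _ ≤ ε * |ξ| ^ a := by gcongr

theorem exists_norm_fourierZ_le_of_le_abs (hF : IsProbability F) (haper : IsAperiodic F) {δ : ℝ}
    (hδ : 0 < δ) : ∃ r < 1, ∀ ξ, δ ≤ |ξ| → |ξ| ≤ Real.pi → ‖fourierZ F ξ‖ ≤ r := by
  have hcompact : IsCompact {ξ : ℝ | δ ≤ |ξ| ∧ |ξ| ≤ Real.pi} := by
    refine isCompact_Icc.of_isClosed_subset ?_ fun ξ hξ => abs_le.1 hξ.2
    exact (isClosed_le continuous_const continuous_abs).inter
      (isClosed_le continuous_abs continuous_const)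
  rcases Set.eq_empty_or_nonempty {ξ : ℝ | δ ≤ |ξ| ∧ |ξ| ≤ Real.pi} with hempty | hne
  · exact ⟨0, one_pos, fun ξ h1 h2 => (hempty.subset ⟨h1, h2⟩).elim⟩
  · obtain ⟨ξ₁, hξ₁, hmax⟩ := hcompact.exists_isMaxOn hne
      (continuous_fourierZ hF.hasSum.summable.norm).norm.continuousOn
    exact ⟨_, norm_fourierZ_lt_one hF haper hξ₁.2 (abs_pos.1 (hδ.trans_le hξ₁.1)),
      fun ξ h1 h2 => hmax ⟨h1, h2⟩⟩

theorem exists_norm_fourierZ_le_exp {C ε : ℝ} (hF : IsProbability F) (haper : IsAperiodic F)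
    (ha : 0 < a) (hε : 0 < ε) (hre : ∀ ξ, |ξ| ≤ ε → ε * |ξ| ^ a ≤ 1 - (fourierZ F ξ).re)
    (hC : ∀ ξ, |ξ| ≤ Real.pi → ‖1 - fourierZ F ξ‖ ≤ C * |ξ| ^ a) :
    ∃ c > 0, ∀ ξ, |ξ| ≤ Real.pi → ‖fourierZ F ξ‖ ≤ Real.exp (-(c * |ξ| ^ a)) := by
  obtain ⟨δ, hδ, hnear⟩ := exists_norm_fourierZ_le_exp_near_zero ha hε hre hC
  obtain ⟨r, hr, hfar⟩ := exists_norm_fourierZ_le_of_le_abs hF haper hδ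
  have hpi : 0 < Real.pi ^ a := by positivity
  refine ⟨min (ε / 2) ((1 - r) / Real.pi ^ a),
    lt_min (half_pos hε) (div_pos (sub_pos.2 hr) hpi), fun ξ hξ => ?_⟩
  rcases le_total |ξ| δ with hle | hge
  · refine (hnear ξ hle).trans (Real.exp_le_exp.2 (neg_le_neg ?_))
    gcongr
    exact min_le_left _ _
  · have hmul : min (ε / 2) ((1 - r) / Real.pi ^ a) * |ξ| ^ a ≤ 1 - r :=
      calc _ ≤ (1 - r) / Real.pi ^ a * Real.pi ^ a := by
            refine mul_le_mul (min_le_right _ _) (Real.rpow_le_rpow (abs_nonneg _) hξ ha.le)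
              (by positivity) (div_pos (sub_pos.2 hr) hpi).le
        _ = 1 - r := div_mul_cancel₀ _ hpi.ne'
    calc ‖fourierZ F ξ‖ ≤ -(1 - r) + 1 := by linarith [hfar ξ hge hξ]
      _ ≤ Real.exp (-(1 - r)) := Real.add_one_le_exp _
      _ ≤ _ := Real.exp_le_exp.2 (neg_le_neg hmul)

end Decay

section Powers

open MeasureTheory in
theorem integral_norm_sq_le_of_norm_le {g : ℝ → ℂ} (hg : Continuous g) {D h r : ℝ} (hh : 0 < h)
    (hr : 1 < 2 * r) (hgD : ∀ ξ, |ξ| ≤ Real.pi → ‖g ξ‖ ≤ D * (1 + |ξ| / h) ^ (-r)) :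
    ∫ x in (-Real.pi)..Real.pi, ‖g x‖ ^ 2 ≤ D ^ 2 * (h * ∫ x : ℝ, (1 + ‖x‖) ^ (-(2 * r))) := by
  have hint : Integrable fun x : ℝ => D ^ 2 * (1 + ‖x / h‖) ^ (-(2 * r)) :=
    ((integrable_one_add_norm (by simpa using hr)).comp_div hh.ne').const_mul _
  have hle : ∀ x ∈ Set.Ioc (-Real.pi) Real.pi,
      ‖g x‖ ^ 2 ≤ D ^ 2 * (1 + ‖x / h‖) ^ (-(2 * r)) := fun x hx => by
    calc ‖g x‖ ^ 2 ≤ (D * (1 + |x| / h) ^ (-r)) ^ 2 := by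
          gcongr
          exact hgD x (abs_le.2 ⟨hx.1.le, hx.2⟩)
      _ = D ^ 2 * (1 + ‖x / h‖) ^ (-(2 * r)) := by
          rw [Real.norm_eq_abs, abs_div, abs_of_pos hh, mul_pow, ← Real.rpow_mul_natCast
            (by positivity)]
          ring_nf
  calc ∫ x in (-Real.pi)..Real.pi, ‖g x‖ ^ 2
      = ∫ x in Set.Ioc (-Real.pi) Real.pi, ‖g x‖ ^ 2 :=
        intervalIntegral.integral_of_le (by linarith [Real.pi_pos])
    _ ≤ ∫ x in Set.Ioc (-Real.pi) Real.pi, D ^ 2 * (1 + ‖x / h‖) ^ (-(2 * r)) :=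
        setIntegral_mono_on (hg.norm.pow 2).integrableOn_Ioc hint.integrableOn measurableSet_Ioc hle
    _ ≤ ∫ x : ℝ, D ^ 2 * (1 + ‖x / h‖) ^ (-(2 * r)) :=
        setIntegral_le_integral hint (.of_forall fun x => by positivity)
    _ = D ^ 2 * (h * ∫ x : ℝ, (1 + ‖x‖) ^ (-(2 * r))) := by
        rw [integral_const_mul, Measure.integral_comp_div (fun x : ℝ => (1 + ‖x‖) ^ (-(2 * r))) h,
          abs_of_pos hh, smul_eq_mul]

theorem rpow_mul_exp_neg_le {p c u : ℝ} (hp : 0 < p) (hc : 0 < c) (hu : 0 ≤ u) :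
    u ^ p * Real.exp (-(c * u)) ≤ (p / c) ^ p := by
  have hexp : c * u / p ≤ Real.exp (c * u / p) := by linarith [Real.add_one_le_exp (c * u / p)]
  calc u ^ p * Real.exp (-(c * u))
      = (p / c) ^ p * (c * u / p) ^ p * Real.exp (-(c * u)) := by
        rw [← Real.mul_rpow (by positivity) (by positivity)]
        field_simp
    _ ≤ (p / c) ^ p * Real.exp (c * u / p) ^ p * Real.exp (-(c * u)) := by gcongr
    _ = (p / c) ^ p := by
        rw [← Real.exp_mul, div_mul_cancel₀ _ hp.ne', mul_assoc, ← Real.exp_add, add_neg_cancel,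
          Real.exp_zero, mul_one]

variable {w : ℝ → ℂ} {C a c ξ : ℝ}

theorem norm_one_sub_pow_mul_le (hw : PowerBound w C a)
    (hexp : ∀ ξ, |ξ| ≤ Real.pi → ‖1 - w ξ‖ ≤ Real.exp (-(c * |ξ| ^ a))) (hξ : |ξ| ≤ Real.pi)
    (n : ℕ) : ‖(1 - w ξ) ^ n * w ξ‖ ≤ C * |ξ| ^ a * Real.exp (-(c * (n * |ξ| ^ a))) := by
  have hpow : ‖1 - w ξ‖ ^ n ≤ Real.exp (-(c * (n * |ξ| ^ a))) :=
    calc ‖1 - w ξ‖ ^ n ≤ Real.exp (-(c * |ξ| ^ a)) ^ n := by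
          gcongr
          exact hexp ξ hξ
      _ = Real.exp (-(c * (n * |ξ| ^ a))) := by rw [← Real.exp_nat_mul]; ring_nf
  rw [norm_mul, norm_pow, mul_comm]
  exact mul_le_mul (hw.norm_le ξ hξ) hpow (by positivity)
    ((norm_nonneg _).trans (hw.norm_le ξ hξ))

theorem norm_deriv_one_sub_pow_succ_mul_le (hw : PowerBound w C a) (ha : 0 ≤ a) (hc : 0 ≤ c)
    (hexp : ∀ ξ, |ξ| ≤ Real.pi → ‖1 - w ξ‖ ≤ Real.exp (-(c * |ξ| ^ a))) (hξ : |ξ| ≤ Real.pi)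
    (hξ0 : ξ ≠ 0) (n : ℕ) :
    ‖deriv (fun x => (1 - w x) ^ (n + 1) * w x) ξ‖ ≤
      C * |ξ| ^ (a - 1) * Real.exp (c * Real.pi ^ a) *
        ((1 + C * ((n + 1 : ℕ) * |ξ| ^ a)) * Real.exp (-(c * ((n + 1 : ℕ) * |ξ| ^ a)))) := by
  have hw' := (hw.differentiableAt ξ hξ hξ0).hasDerivAt
  have hderiv : deriv (fun x => (1 - w x) ^ (n + 1) * w x) ξ =
      (1 - w ξ) ^ n * deriv w ξ * (1 - w ξ - (n + 1 : ℕ) * w ξ) := by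
    rw [(((hw'.const_sub 1).fun_pow (n + 1)).fun_mul hw').deriv, add_tsub_cancel_right]
    ring
  have hpow : ‖1 - w ξ‖ ^ n ≤
      Real.exp (c * Real.pi ^ a) * Real.exp (-(c * ((n + 1 : ℕ) * |ξ| ^ a))) := by
    refine (pow_le_pow_left₀ (norm_nonneg _) (hexp ξ hξ) n).trans ?_
    rw [← Real.exp_nat_mul, ← Real.exp_add, Real.exp_le_exp]
    push_cast
    linarith [mul_le_mul_of_nonneg_left (Real.rpow_le_rpow (abs_nonneg ξ) hξ ha) hc]
  have hone : ‖1 - w ξ‖ ≤ 1 :=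
    (hexp ξ hξ).trans (Real.exp_le_one_iff.2 (neg_nonpos.2 (by positivity)))
  have hlin : ‖1 - w ξ - (n + 1 : ℕ) * w ξ‖ ≤ 1 + C * ((n + 1 : ℕ) * |ξ| ^ a) := by
    refine (norm_sub_le _ _).trans (add_le_add hone ?_)
    rw [norm_mul, Complex.norm_natCast, mul_left_comm]
    gcongr
    exact hw.norm_le ξ hξ
  have hC := hw.nonneg
  rw [hderiv, norm_mul, norm_mul, norm_pow]
  calc ‖1 - w ξ‖ ^ n * ‖deriv w ξ‖ * ‖1 - w ξ - (n + 1 : ℕ) * w ξ‖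
      ≤ Real.exp (c * Real.pi ^ a) * Real.exp (-(c * ((n + 1 : ℕ) * |ξ| ^ a))) *
          (C * |ξ| ^ (a - 1)) * (1 + C * ((n + 1 : ℕ) * |ξ| ^ a)) := by
        gcongr
        exact hw.norm_deriv_le ξ hξ hξ0
    _ = _ := by ring

theorem rpow_half_eq {s x : ℝ} (hs : 0 < s) (hx : 0 ≤ x) (a : ℝ) :
    x ^ (a / 2) = s ^ (-(1 / 2) : ℝ) * (s * x ^ a) ^ (1 / 2 : ℝ) := by
  rw [Real.mul_rpow hs.le (by positivity), ← Real.rpow_mul hx, ← mul_assoc, ← Real.rpow_add hs,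
    neg_add_cancel, Real.rpow_zero, one_mul, mul_one_div]

theorem norm_one_sub_pow_mul_le_rpow_half (hw : PowerBound w C a) (ha : 0 ≤ a) (hc : 0 < c)
    (hexp : ∀ ξ, |ξ| ≤ Real.pi → ‖1 - w ξ‖ ≤ Real.exp (-(c * |ξ| ^ a))) (hξ : |ξ| ≤ Real.pi)
    {n : ℕ} (hn : 1 ≤ n) :
    ‖(1 - w ξ) ^ n * w ξ‖ ≤
      C * (1 / 2 / c) ^ (1 / 2 : ℝ) * (n : ℝ) ^ (-(1 / 2) : ℝ) * |ξ| ^ (a / 2) := by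
  have hn0 : (0 : ℝ) < n := by exact_mod_cast hn
  have hC := hw.nonneg
  have hhalf := rpow_half_eq hn0 (abs_nonneg ξ) a
  set u := (n : ℝ) * |ξ| ^ a
  calc ‖(1 - w ξ) ^ n * w ξ‖ ≤ C * |ξ| ^ a * Real.exp (-(c * u)) :=
        norm_one_sub_pow_mul_le hw hexp hξ n
    _ = C * |ξ| ^ (a / 2) * |ξ| ^ (a / 2) * Real.exp (-(c * u)) := by
        rw [mul_assoc C (|ξ| ^ (a / 2)), ← Real.rpow_add_of_nonneg (abs_nonneg ξ) (by linarith)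
          (by linarith), add_halves]
    _ = C * (n : ℝ) ^ (-(1 / 2) : ℝ) * |ξ| ^ (a / 2) *
          (u ^ (1 / 2 : ℝ) * Real.exp (-(c * u))) := by
        nth_rewrite 2 [hhalf]
        ring
    _ ≤ C * (n : ℝ) ^ (-(1 / 2) : ℝ) * |ξ| ^ (a / 2) * (1 / 2 / c) ^ (1 / 2 : ℝ) := by
        gcongr
        exact rpow_mul_exp_neg_le (by norm_num) hc (by positivity)
    _ = _ := by ring

theorem norm_deriv_one_sub_pow_mul_le_rpow_half (hw : PowerBound w C a) (ha : 0 ≤ a)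
    (hc : 0 < c) (hexp : ∀ ξ, |ξ| ≤ Real.pi → ‖1 - w ξ‖ ≤ Real.exp (-(c * |ξ| ^ a)))
    (hξ : |ξ| ≤ Real.pi) (hξ0 : ξ ≠ 0) {n : ℕ} (hn : 1 ≤ n) :
    ‖deriv (fun x => (1 - w x) ^ n * w x) ξ‖ ≤
      C * Real.exp (c * Real.pi ^ a) *
        ((1 / 2 / c) ^ (1 / 2 : ℝ) + C * (3 / 2 / c) ^ (3 / 2 : ℝ)) *
        (n : ℝ) ^ (-(1 / 2) : ℝ) * |ξ| ^ (a / 2 - 1) := by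
  have hn0 : (0 : ℝ) < n := by exact_mod_cast hn
  have hC := hw.nonneg
  have hhalf := rpow_half_eq hn0 (abs_nonneg ξ) a
  obtain ⟨m, rfl⟩ := Nat.exists_eq_add_of_le' hn
  set u := ((m + 1 : ℕ) : ℝ) * |ξ| ^ a
  have hu : 0 ≤ u := by positivity
  have hL : u ^ (1 / 2 : ℝ) * u * Real.exp (-(c * u)) ≤ (3 / 2 / c) ^ (3 / 2 : ℝ) := by
    rw [← Real.rpow_add_one' hu (by norm_num), show (1 / 2 + 1 : ℝ) = 3 / 2 by norm_num]
    exact rpow_mul_exp_neg_le (by norm_num) hc hu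
  have hsplit : |ξ| ^ (a - 1) =
      |ξ| ^ (a / 2 - 1) * (((m + 1 : ℕ) : ℝ) ^ (-(1 / 2) : ℝ) * u ^ (1 / 2 : ℝ)) := by
    rw [← hhalf, ← Real.rpow_add (abs_pos.2 hξ0)]
    ring_nf
  calc ‖deriv (fun x => (1 - w x) ^ (m + 1) * w x) ξ‖
      ≤ C * |ξ| ^ (a - 1) * Real.exp (c * Real.pi ^ a) *
          ((1 + C * u) * Real.exp (-(c * u))) :=
        norm_deriv_one_sub_pow_succ_mul_le hw ha hc.le hexp hξ hξ0 m
    _ = C * Real.exp (c * Real.pi ^ a) * (u ^ (1 / 2 : ℝ) * Real.exp (-(c * u)) +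
          C * (u ^ (1 / 2 : ℝ) * u * Real.exp (-(c * u)))) *
          ((m + 1 : ℕ) : ℝ) ^ (-(1 / 2) : ℝ) * |ξ| ^ (a / 2 - 1) := by
        rw [hsplit]
        ring
    _ ≤ _ := by
        gcongr
        exact rpow_mul_exp_neg_le (by norm_num) hc hu

theorem exists_powerBound_one_sub_pow_mul (hw : PowerBound w C a) (ha : 0 ≤ a) (hc : 0 < c)
    (hexp : ∀ ξ, |ξ| ≤ Real.pi → ‖1 - w ξ‖ ≤ Real.exp (-(c * |ξ| ^ a))) :
    ∃ A, 0 ≤ A ∧ ∀ n : ℕ, 1 ≤ n →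
      PowerBound (fun ξ => (1 - w ξ) ^ n * w ξ) (A * (n : ℝ) ^ (-(1 / 2) : ℝ)) (a / 2) := by
  have hC := hw.nonneg
  refine ⟨max (C * (1 / 2 / c) ^ (1 / 2 : ℝ)) (C * Real.exp (c * Real.pi ^ a) *
    ((1 / 2 / c) ^ (1 / 2 : ℝ) + C * (3 / 2 / c) ^ (3 / 2 : ℝ))), by positivity,
    fun n hn => ⟨fun ξ hξ => ?_, fun ξ hξ hξ0 => ?_, fun ξ hξ hξ0 => ?_⟩⟩
  · refine (norm_one_sub_pow_mul_le_rpow_half hw ha hc hexp hξ hn).trans ?_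
    gcongr
    exact le_max_left _ _
  · have hw' := hw.differentiableAt ξ hξ hξ0
    exact ((hw'.const_sub 1).fun_pow n).fun_mul hw'
  · refine (norm_deriv_one_sub_pow_mul_le_rpow_half hw ha hc hexp hξ hξ0 hn).trans ?_
    gcongr
    exact le_max_right _ _

theorem norm_one_sub_pow_mul_le_div_mul_rpow_neg_one (hw : PowerBound w C a) (ha : 0 < a)
    (hc : 0 < c) (hexp : ∀ ξ, |ξ| ≤ Real.pi → ‖1 - w ξ‖ ≤ Real.exp (-(c * |ξ| ^ a)))
    (hξ : |ξ| ≤ Real.pi) {n : ℕ} (hn : 1 ≤ n) :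
    ‖(1 - w ξ) ^ n * w ξ‖ ≤ C * (1 / c + ((1 + 1 / a) / c) ^ (1 + 1 / a)) / n *
      (1 + |ξ| / (n : ℝ) ^ (-(1 / a))) ^ (-1 : ℝ) := by
  have hC := hw.nonneg
  have hn0 : (0 : ℝ) < n := by exact_mod_cast hn
  refine (norm_one_sub_pow_mul_le hw hexp hξ n).trans ?_
  set u := (n : ℝ) * |ξ| ^ a with hu
  have hun : 0 ≤ u := by positivity
  have hscale : |ξ| / (n : ℝ) ^ (-(1 / a)) = u ^ (1 / a) := by
    rw [hu, Real.mul_rpow hn0.le (by positivity), ← Real.rpow_mul (abs_nonneg ξ),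
      mul_one_div_cancel ha.ne', Real.rpow_one, Real.rpow_neg hn0.le, div_inv_eq_mul, mul_comm]
  have hlin := rpow_mul_exp_neg_le one_pos hc hun
  have hpow := rpow_mul_exp_neg_le (p := 1 + 1 / a) (by positivity) hc hun
  rw [Real.rpow_one, Real.rpow_one] at hlin
  rw [Real.rpow_add_of_nonneg hun zero_le_one (by positivity), Real.rpow_one] at hpow
  rw [hscale, Real.rpow_neg_one, ← div_eq_mul_inv, le_div_iff₀ (by positivity),
    le_div_iff₀ hn0]
  calc C * |ξ| ^ a * Real.exp (-(c * u)) * (1 + u ^ (1 / a)) * n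
      = C * (u * Real.exp (-(c * u)) + u * u ^ (1 / a) * Real.exp (-(c * u))) := by
        rw [hu]
        ring
    _ ≤ C * (1 / c + ((1 + 1 / a) / c) ^ (1 + 1 / a)) := by
        gcongr

theorem exists_mul_integral_norm_sq_one_sub_pow_mul_le (hcont : Continuous w)
    (hw : PowerBound w C a) (ha : 0 < a) (hc : 0 < c)
    (hexp : ∀ ξ, |ξ| ≤ Real.pi → ‖1 - w ξ‖ ≤ Real.exp (-(c * |ξ| ^ a))) :
    ∃ B, 0 ≤ B ∧ ∀ n : ℕ, 1 ≤ n →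
      (n : ℝ) ^ (1 / a) * ∫ x in (-Real.pi)..Real.pi, ‖(1 - w x) ^ n * w x‖ ^ 2 ≤ (B / n) ^ 2 := by
  have hC := hw.nonneg
  set K := 1 / c + ((1 + 1 / a) / c) ^ (1 + 1 / a)
  set J := ∫ x : ℝ, (1 + ‖x‖) ^ (-(2 * 1) : ℝ)
  have hJ : 0 ≤ J := MeasureTheory.integral_nonneg fun x => by positivity
  refine ⟨C * K * √J, by positivity, fun n hn => ?_⟩
  have hn0 : (0 : ℝ) < n := by exact_mod_cast hn
  have hbound : ∀ ξ, |ξ| ≤ Real.pi → ‖(1 - w ξ) ^ n * w ξ‖ ≤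
      C * K / n * (1 + |ξ| / (n : ℝ) ^ (-(1 / a))) ^ (-1 : ℝ) := fun ξ hξ =>
    norm_one_sub_pow_mul_le_div_mul_rpow_neg_one hw ha hc hexp hξ hn
  have hint := integral_norm_sq_le_of_norm_le (((continuous_const.sub hcont).pow n).mul hcont)
    (by positivity) (by norm_num) hbound
  calc (n : ℝ) ^ (1 / a) * ∫ x in (-Real.pi)..Real.pi, ‖(1 - w x) ^ n * w x‖ ^ 2
      ≤ (n : ℝ) ^ (1 / a) * ((C * K / n) ^ 2 * ((n : ℝ) ^ (-(1 / a)) * J)) := by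
        gcongr
        exact hint
    _ = (C * K * √J / n) ^ 2 := by
        rw [Real.rpow_neg hn0.le, div_pow, div_pow, mul_pow (C * K), Real.sq_sqrt hJ]
        field_simp

end Powers

section Bernstein

section Increment

variable {φ : ℝ → ℂ} {A b ξ h : ℝ}

theorem exists_sub_int_mul_two_pi (ξ : ℝ) :
    ∃ m : ℤ, |ξ - m * (2 * Real.pi)| ≤ Real.pi ∧
      ‖(ξ : AddCircle (2 * Real.pi))‖ = |ξ - m * (2 * Real.pi)| := by
  have hnorm := AddCircle.norm_eq (p := 2 * Real.pi) (x := ξ)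
  refine ⟨_, ?_, hnorm⟩
  rw [← hnorm]
  refine (AddCircle.norm_le_half_period _ Real.two_pi_pos.ne').trans ?_
  rw [abs_of_pos Real.two_pi_pos, mul_div_cancel_left₀ _ two_ne_zero]

theorem PowerBound.norm_le_addCircle_norm (hA : PowerBound φ A b)
    (hφ : Function.Periodic φ (2 * Real.pi)) (ξ : ℝ) :
    ‖φ ξ‖ ≤ A * ‖(ξ : AddCircle (2 * Real.pi))‖ ^ b := by
  obtain ⟨m, hm, hnorm⟩ := exists_sub_int_mul_two_pi ξ
  rw [hnorm, ← hφ.sub_int_mul_eq m]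
  exact hA.norm_le _ hm

theorem PowerBound.differentiableAt_and_norm_deriv_le (hA : PowerBound φ A b)
    (hφ : Function.Periodic φ (2 * Real.pi)) (hξ : 0 < ‖(ξ : AddCircle (2 * Real.pi))‖) :
    DifferentiableAt ℝ φ ξ ∧ ‖deriv φ ξ‖ ≤ A * ‖(ξ : AddCircle (2 * Real.pi))‖ ^ (b - 1) := by
  obtain ⟨m, hm, hnorm⟩ := exists_sub_int_mul_two_pi ξ
  rw [hnorm] at hξ ⊢
  have hshift : (fun x => φ (x - m * (2 * Real.pi))) = φ := funext fun x => hφ.sub_int_mul_eq m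
  have hderiv := (hA.differentiableAt _ hm (abs_pos.1 hξ)).hasDerivAt.comp_sub_const ξ _
  rw [hshift] at hderiv
  refine ⟨hderiv.differentiableAt, ?_⟩
  rw [hderiv.deriv]
  exact hA.norm_deriv_le _ hm (abs_pos.1 hξ)

theorem rpow_sub_one_le_two_mul {x y : ℝ} (hx : 0 < x) (hxy : x / 2 ≤ y) (hb0 : 0 ≤ b)
    (hb1 : b ≤ 1) : y ^ (b - 1) ≤ 2 * x ^ (b - 1) := by
  calc y ^ (b - 1) ≤ (x / 2) ^ (b - 1) :=
        Real.rpow_le_rpow_of_nonpos (by positivity) hxy (by linarith)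
    _ = 2 ^ (1 - b) * x ^ (b - 1) := by
        rw [Real.div_rpow hx.le zero_le_two, ← neg_sub 1 b, Real.rpow_neg zero_le_two,
          div_inv_eq_mul, mul_comm]
    _ ≤ 2 * x ^ (b - 1) := by
        gcongr
        exact Real.rpow_le_self_of_one_le one_le_two (by linarith)

theorem PowerBound.norm_add_sub_le_of_abs_le (hA : PowerBound φ A b)
    (hφ : Function.Periodic φ (2 * Real.pi)) (hb0 : 0 ≤ b) (hb1 : b ≤ 1) (hh : 0 < h)
    (hξ : |ξ| ≤ 2 * h) :
    ‖φ (ξ + h) - φ ξ‖ ≤ 6 * A * h ^ b * (1 + |ξ| / h) ^ (b - 1) := by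
  have hA0 := hA.nonneg
  have hone : 1 + |ξ| / h ≤ 3 := by linarith [(div_le_iff₀ hh).2 hξ]
  have hnear : ∀ η : ℝ, |η| ≤ 3 * h → ‖φ η‖ ≤ 3 * A * h ^ b * (1 + |ξ| / h) ^ (b - 1) := by
    intro η hη
    calc ‖φ η‖ ≤ A * ‖(η : AddCircle (2 * Real.pi))‖ ^ b := hA.norm_le_addCircle_norm hφ η
      _ ≤ A * (3 * h) ^ b := by
          gcongr
          exact QuotientAddGroup.norm_mk_le_norm.trans hη
      _ = 3 * A * h ^ b * 3 ^ (b - 1) := by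
          rw [Real.mul_rpow zero_le_three hh.le, Real.rpow_sub_one three_ne_zero]
          ring
      _ ≤ 3 * A * h ^ b * (1 + |ξ| / h) ^ (b - 1) := by
          gcongr ?_ * ?_
          exact Real.rpow_le_rpow_of_nonpos (by positivity) hone (by linarith)
  have hadd : |ξ + h| ≤ 3 * h := (abs_add_le ξ h).trans (by rw [abs_of_pos hh]; linarith)
  linarith [norm_sub_le (φ (ξ + h)) (φ ξ), hnear _ hadd, hnear ξ (by linarith)]

theorem PowerBound.norm_add_sub_le_of_lt_abs (hA : PowerBound φ A b)
    (hφ : Function.Periodic φ (2 * Real.pi)) (hb0 : 0 ≤ b) (hb1 : b ≤ 1) (hh : 0 < h)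
    (hξ : 2 * h < |ξ|) (hξπ : |ξ| ≤ Real.pi) :
    ‖φ (ξ + h) - φ ξ‖ ≤ 4 * A * h ^ b * (1 + |ξ| / h) ^ (b - 1) := by
  have hA0 := hA.nonneg
  have hx : 0 < |ξ| := by linarith
  have hnorm : ‖(ξ : AddCircle (2 * Real.pi))‖ = |ξ| :=
    (AddCircle.norm_coe_eq_abs_iff _ Real.two_pi_pos.ne').2 (by
      rwa [abs_of_pos Real.two_pi_pos, mul_div_cancel_left₀ _ two_ne_zero])
  have hseg : ∀ t ∈ Set.Icc ξ (ξ + h), |ξ| / 2 ≤ ‖(t : AddCircle (2 * Real.pi))‖ := by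
    intro t ht
    have hdist : ‖((ξ - t : ℝ) : AddCircle (2 * Real.pi))‖ ≤ h :=
      QuotientAddGroup.norm_mk_le_norm.trans (abs_le.2 ⟨by linarith [ht.2], by linarith [ht.1]⟩)
    rw [AddCircle.coe_sub] at hdist
    linarith [norm_sub_norm_le (ξ : AddCircle (2 * Real.pi)) t]
  have hderiv : ∀ t ∈ Set.Icc ξ (ξ + h),
      DifferentiableAt ℝ φ t ∧ ‖deriv φ t‖ ≤ 2 * A * |ξ| ^ (b - 1) := by
    intro t ht
    have hbound := hA.differentiableAt_and_norm_deriv_le (ξ := t) hφ (by linarith [hseg t ht])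
    refine ⟨hbound.1, hbound.2.trans ?_⟩
    rw [mul_comm 2 A, mul_assoc A]
    gcongr
    exact rpow_sub_one_le_two_mul hx (hseg t ht) hb0 hb1
  have hmean : ‖φ (ξ + h) - φ ξ‖ ≤ 2 * A * |ξ| ^ (b - 1) * h := by
    simpa only [add_sub_cancel_left] using norm_image_sub_le_of_norm_deriv_le_segment'
      (fun t ht => (hderiv t ht).1.hasDerivAt.hasDerivWithinAt)
      (fun t ht => (hderiv t (Set.Ico_subset_Icc_self ht)).2) (ξ + h)
      (Set.right_mem_Icc.2 (by linarith))
  have hratio : (|ξ| / h) ^ (b - 1) ≤ 2 * (1 + |ξ| / h) ^ (b - 1) :=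
    rpow_sub_one_le_two_mul (by positivity) (by linarith [(lt_div_iff₀ hh).2 hξ]) hb0 hb1
  calc ‖φ (ξ + h) - φ ξ‖ ≤ 2 * A * |ξ| ^ (b - 1) * h := hmean
    _ = 2 * A * h ^ b * (|ξ| / h) ^ (b - 1) := by
        rw [Real.div_rpow hx.le hh.le, Real.rpow_sub_one hh.ne' b]
        field_simp
    _ ≤ 2 * A * h ^ b * (2 * (1 + |ξ| / h) ^ (b - 1)) := by gcongr
    _ = 4 * A * h ^ b * (1 + |ξ| / h) ^ (b - 1) := by ring

theorem PowerBound.norm_add_sub_le (hA : PowerBound φ A b)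
    (hφ : Function.Periodic φ (2 * Real.pi)) (hb0 : 0 ≤ b) (hb1 : b ≤ 1) (hh : 0 < h)
    (hξ : |ξ| ≤ Real.pi) :
    ‖φ (ξ + h) - φ ξ‖ ≤ 6 * A * h ^ b * (1 + |ξ| / h) ^ (b - 1) := by
  rcases le_or_gt |ξ| (2 * h) with hnear | hfar
  · exact hA.norm_add_sub_le_of_abs_le hφ hb0 hb1 hh hnear
  · have hA0 := hA.nonneg
    refine (hA.norm_add_sub_le_of_lt_abs hφ hb0 hb1 hh hfar hξ).trans ?_
    gcongr
    norm_num

end Increment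

theorem sum_norm_le_of_card_mul_sum_norm_sq_le {ι E : Type*} [SeminormedAddCommGroup E]
    {f : ι → E} {S : Finset ι} {D : ℝ} (hD : 0 ≤ D)
    (h : (S.card : ℝ) * ∑ k ∈ S, ‖f k‖ ^ 2 ≤ D ^ 2) : ∑ k ∈ S, ‖f k‖ ≤ D :=
  le_of_sq_le_sq (sq_sum_le_card_mul_sum_sq.trans h) hD

theorem half_le_norm_circle_exp_pow_sub_one {N k : ℕ} (hN : 0 < N) (hNk : N ≤ k)
    (hkN : k ≤ 2 * N) : 1 / 2 ≤ ‖(Circle.exp (-(1 / N)) : ℂ) ^ k - 1‖ := by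
  have hN' : (0 : ℝ) < N := by exact_mod_cast hN
  have hNk' : (N : ℝ) ≤ k := by exact_mod_cast hNk
  have hkN' : (k : ℝ) ≤ 2 * N := by exact_mod_cast hkN
  have habs : |-((k : ℝ) / N)| = k / N := by rw [abs_neg, abs_of_nonneg (by positivity)]
  have hone : 1 ≤ (k : ℝ) / N := (one_le_div₀ hN').2 hNk'
  have htwo : (k : ℝ) / N ≤ 2 := (div_le_iff₀ hN').2 hkN'
  have hchord := two_mul_abs_le_pi_mul_norm_circle_exp_sub_one (x := -((k : ℝ) / N))
    (by rw [habs]; linarith [Real.pi_gt_three])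
  have hpow : Circle.exp (-((k : ℝ) / N)) = Circle.exp (-(1 / N)) ^ k := by
    rw [← Circle.exp_nsmul, nsmul_eq_mul]
    ring_nf
  rw [habs, hpow, Circle.coe_pow] at hchord
  have hfour := mul_le_mul_of_nonneg_right Real.pi_le_four
    (norm_nonneg ((Circle.exp (-(1 / N)) : ℂ) ^ k - 1))
  linarith

theorem norm_sq_le_four_mul_norm_mul_circle_exp_pow_sub_one_sq {N k : ℕ} (hN : 0 < N)
    (hNk : N ≤ k) (hkN : k ≤ 2 * N) (w : ℂ) :
    ‖w‖ ^ 2 ≤ 4 * ‖w * ((Circle.exp (-(1 / N)) : ℂ) ^ k - 1)‖ ^ 2 := by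
  have hfactor := half_le_norm_circle_exp_pow_sub_one hN hNk hkN
  have hle : ‖w‖ ≤ 2 * ‖w * ((Circle.exp (-(1 / N)) : ℂ) ^ k - 1)‖ := by
    rw [norm_mul]
    linarith [mul_le_mul_of_nonneg_left hfactor (norm_nonneg w)]
  calc ‖w‖ ^ 2 ≤ (2 * ‖w * ((Circle.exp (-(1 / N)) : ℂ) ^ k - 1)‖) ^ 2 := by gcongr
    _ = 4 * ‖w * ((Circle.exp (-(1 / N)) : ℂ) ^ k - 1)‖ ^ 2 := by ring

variable {f : ℕ → ℂ} {A B b M : ℝ}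

/- The increment of the transform by `1 / N` multiplies the coefficients of index in `[N, 2N)` by a
factor bounded below. -/
theorem sum_Ico_two_mul_norm_le (hf : Summable fun k => ‖f k‖) (hA : PowerBound (fourierC f) A b)
    (hb0 : 0 ≤ b) (hb1 : b < 1 / 2) {N : ℕ} (hN : 0 < N) :
    ∑ k ∈ Finset.Ico N (2 * N), ‖f k‖ ≤
      12 * A * √(∫ x : ℝ, (1 + ‖x‖) ^ (-(2 * (1 - b)))) * (N : ℝ) ^ (-b) := by
  have hA0 := hA.nonneg
  have hN' : (0 : ℝ) < N := by exact_mod_cast hN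
  set J := ∫ x : ℝ, (1 + ‖x‖) ^ (-(2 * (1 - b)))
  have hJ : 0 ≤ J := MeasureTheory.integral_nonneg fun x => by positivity
  let g : ℕ → ℂ := fun k => f k * ((Circle.exp (-(1 / N)) : ℂ) ^ k - 1)
  have hg : Summable fun k => ‖g k‖ := by
    refine .of_nonneg_of_le (fun _ => norm_nonneg _) (fun k => ?_) (hf.mul_right 2)
    rw [norm_mul]
    gcongr
    refine (norm_sub_le _ _).trans ?_
    rw [norm_pow, Circle.norm_coe, one_pow, norm_one]
    norm_num
  have hincr : ∀ ξ, |ξ| ≤ Real.pi →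
      ‖fourierC g ξ‖ ≤ 6 * A * (1 / N) ^ b * (1 + |ξ| / (1 / N)) ^ (-(1 - b)) := fun ξ hξ => by
    rw [fourierC_mul_pow_sub_one hf, neg_sub]
    exact hA.norm_add_sub_le (periodic_fourierC f) hb0 (by linarith) (by positivity) hξ
  have hbessel := (sum_norm_sq_le_integral_norm_fourierC_sq hg (Finset.Ico N (2 * N))).trans
    (integral_norm_sq_le_of_norm_le (continuous_fourierC hg) (by positivity) (by linarith) hincr)
  have hfg : ∀ k ∈ Finset.Ico N (2 * N), ‖f k‖ ^ 2 ≤ 4 * ‖g k‖ ^ 2 := fun k hk =>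
    norm_sq_le_four_mul_norm_mul_circle_exp_pow_sub_one_sq hN (Finset.mem_Ico.1 hk).1
      (Finset.mem_Ico.1 hk).2.le (f k)
  refine sum_norm_le_of_card_mul_sum_norm_sq_le (by positivity) ?_
  rw [Nat.card_Ico, two_mul, Nat.add_sub_cancel]
  calc (N : ℝ) * ∑ k ∈ Finset.Ico N (N + N), ‖f k‖ ^ 2
      ≤ N * (4 * ((6 * A * (1 / N) ^ b) ^ 2 * (1 / N * J))) := by
        gcongr
        rw [← two_mul]
        refine (Finset.sum_le_sum hfg).trans ?_
        rw [← Finset.mul_sum]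
        gcongr
    _ = (12 * A * √J * (N : ℝ) ^ (-b)) ^ 2 := by
        rw [one_div, Real.inv_rpow hN'.le, ← Real.rpow_neg hN'.le, mul_pow (12 * A * √J),
          mul_pow (12 * A), Real.sq_sqrt hJ]
        field_simp
        ring

theorem sum_range_norm_le_of_mul_integral_le (hf : Summable fun k => ‖f k‖) (hB : 0 ≤ B) {N : ℕ}
    (hfB : (N : ℝ) * ∫ x in (-Real.pi)..Real.pi, ‖fourierC f x‖ ^ 2 ≤ B ^ 2) :
    ∑ k ∈ Finset.range N, ‖f k‖ ≤ B := by
  refine sum_norm_le_of_card_mul_sum_norm_sq_le hB ?_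
  rw [Finset.card_range]
  refine le_trans ?_ hfB
  gcongr
  exact sum_norm_sq_le_integral_norm_fourierC_sq hf _

theorem tsum_le_of_dyadic_sum_le {g : ℕ → ℝ} {S T q : ℝ} {N : ℕ} (hg : ∀ k, 0 ≤ g k)
    (hN : 0 < N) (hT : 0 ≤ T) (hq0 : 0 ≤ q) (hq1 : q < 1)
    (hlow : ∑ k ∈ Finset.range N, g k ≤ S)
    (hblock : ∀ j, ∑ k ∈ Finset.Ico (N * 2 ^ j) (2 * (N * 2 ^ j)), g k ≤ T * q ^ j) :
    ∑' k, g k ≤ S + T / (1 - q) := by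
  have hdyadic : ∀ L : ℕ, ∑ k ∈ Finset.range (N * 2 ^ L), g k ≤
      S + T * ∑ j ∈ Finset.range L, q ^ j := by
    intro L
    induction L with
    | zero => simpa using hlow
    | succ L ih =>
      rw [pow_succ', mul_left_comm, ← Finset.sum_range_add_sum_Ico _
        (Nat.le_mul_of_pos_left (N * 2 ^ L) two_pos), Finset.sum_range_succ]
      linarith [hblock L]
  refine Real.tsum_le_of_sum_range_le hg fun n => ?_
  have hn : n ≤ N * 2 ^ n := Nat.lt_two_pow_self.le.trans (Nat.le_mul_of_pos_left _ hN)
  calc ∑ k ∈ Finset.range n, g k ≤ ∑ k ∈ Finset.range (N * 2 ^ n), g k :=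
        Finset.sum_le_sum_of_subset_of_nonneg (Finset.range_subset_range.2 hn) fun _ _ _ => hg _
    _ ≤ S + T * ∑ j ∈ Finset.range n, q ^ j := hdyadic n
    _ ≤ S + T * ∑' j, q ^ j := by
        gcongr
        exact (summable_geometric_of_lt_one hq0 hq1).sum_le_tsum _ fun _ _ => by positivity
    _ = S + T / (1 - q) := by rw [tsum_geometric_of_lt_one hq0 hq1, div_eq_mul_inv]

theorem tsum_norm_le_of_powerBound (hf : Summable fun k => ‖f k‖)
    (hA : PowerBound (fourierC f) A b) (hb0 : 0 < b) (hb1 : b < 1 / 2) (hB : 0 ≤ B) (hM : 1 ≤ M)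
    (hMB : M * ∫ x in (-Real.pi)..Real.pi, ‖fourierC f x‖ ^ 2 ≤ B ^ 2) :
    ∑' k, ‖f k‖ ≤ 2 * B +
      12 * A * √(∫ x : ℝ, (1 + ‖x‖) ^ (-(2 * (1 - b)))) * M ^ (-b) / (1 - 2 ^ (-b)) := by
  set J := √(∫ x : ℝ, (1 + ‖x‖) ^ (-(2 * (1 - b))))
  have hA0 := hA.nonneg
  have hM0 : 0 < M := by linarith
  set N := ⌈M⌉₊
  have hMN : M ≤ N := Nat.le_ceil M
  have hN : 0 < N := Nat.ceil_pos.2 hM0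
  have hN2M : (N : ℝ) ≤ 2 * M := by linarith [Nat.ceil_lt_add_one hM0.le]
  have hlow : ∑ k ∈ Finset.range N, ‖f k‖ ≤ 2 * B := by
    refine sum_range_norm_le_of_mul_integral_le hf (by positivity) ?_
    calc (N : ℝ) * ∫ x in (-Real.pi)..Real.pi, ‖fourierC f x‖ ^ 2
        ≤ 2 * M * ∫ x in (-Real.pi)..Real.pi, ‖fourierC f x‖ ^ 2 := by
          gcongr
          exact intervalIntegral.integral_nonneg (by linarith [Real.pi_pos])
            fun x _ => by positivity
      _ ≤ (2 * B) ^ 2 := by nlinarith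
  have hblock : ∀ j : ℕ, ∑ k ∈ Finset.Ico (N * 2 ^ j) (2 * (N * 2 ^ j)), ‖f k‖ ≤
      12 * A * J * M ^ (-b) * (2 ^ (-b)) ^ j := fun j => by
    calc ∑ k ∈ Finset.Ico (N * 2 ^ j) (2 * (N * 2 ^ j)), ‖f k‖
        ≤ 12 * A * J * ((N * 2 ^ j : ℕ) : ℝ) ^ (-b) :=
          sum_Ico_two_mul_norm_le hf hA hb0.le hb1 (by positivity)
      _ = 12 * A * J * (N : ℝ) ^ (-b) * (2 ^ (-b)) ^ j := by
          push_cast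
          rw [Real.mul_rpow N.cast_nonneg (by positivity), ← Real.rpow_pow_comm zero_le_two,
            ← mul_assoc]
      _ ≤ 12 * A * J * M ^ (-b) * (2 ^ (-b)) ^ j := by
          gcongr ?_ * ?_ * ?_
          exact Real.rpow_le_rpow_of_nonpos hM0 hMN (by linarith)
  exact tsum_le_of_dyadic_sum_le (fun _ => norm_nonneg _) hN (by positivity) (by positivity)
    (Real.rpow_lt_one_of_one_lt_of_neg one_lt_two (by linarith)) hlow hblock

end Bernstein

section RittClass

variable {F : ℕ → ℝ}

theorem summable_norm_convPow_sub_succ (hF : Summable fun k => ‖F k‖) (n : ℕ) :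
    Summable fun k => ‖convPow F n k - convPow F (n + 1) k‖ :=
  ((summable_norm_convPow hF n).of_norm.sub (summable_norm_convPow hF (n + 1)).of_norm).norm

theorem mem_rittClass_of_tsum_norm_sub_le {K : ℝ} (hF : IsProbability F)
    (hK : ∀ n : ℕ, 1 ≤ n → (n : ℝ) * ∑' k, ‖convPow F n k - convPow F (n + 1) k‖ ≤ K) :
    F ∈ rittClass := by
  have hFs := hF.hasSum.summable.norm
  refine ⟨hF, lt_of_le_of_lt (iSup₂_le fun n hn => ?_) (ENNReal.ofReal_lt_top (r := K))⟩
  have hl1 : l1Norm (convPow F n - convPow F (n + 1)) =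
      ENNReal.ofReal (∑' k, ‖convPow F n k - convPow F (n + 1) k‖) := by
    rw [l1Norm, ENNReal.ofReal_tsum_of_nonneg (fun _ => norm_nonneg _)
      (summable_norm_convPow_sub_succ hFs n)]
    exact tsum_congr fun k => (ofReal_norm _).symm
  rw [hl1, ← ENNReal.ofReal_natCast, ← ENNReal.ofReal_mul n.cast_nonneg]
  exact ENNReal.ofReal_le_ofReal (hK n hn)

theorem fourierC_convPow_sub_convPow_succ (hF : Summable fun k => ‖F k‖) (n : ℕ) :
    fourierC (fun k => ((convPow F n k - convPow F (n + 1) k : ℝ) : ℂ)) =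
      fun ξ => (1 - (1 - fourierZ F ξ)) ^ n * (1 - fourierZ F ξ) := by
  have hsummable : ∀ m, Summable fun k => ‖(convPow F m k : ℂ)‖ := fun m => by
    simpa only [Complex.norm_real] using summable_norm_convPow hF m
  ext ξ
  have hsub := fourierC_sub (hsummable n) (hsummable (n + 1)) ξ
  rw [← fourierZ_eq_fourierC, ← fourierZ_eq_fourierC, fourierZ_convPow hF,
    fourierZ_convPow hF] at hsub
  simp only [Complex.ofReal_sub]
  refine hsub.trans ?_
  ring

theorem FourierCriterion.exists_powerBound {a : ℝ} (h : FourierCriterion a F) (ha : 0 < a)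
    (ha1 : a ≤ 1) : ∃ C, PowerBound (fun ξ => 1 - fourierZ F ξ) C a := by
  obtain ⟨-, -, -, D, -, -, hderiv⟩ := h.bounds
  refine ⟨D / a, powerBound_of_norm_deriv_le
    (continuous_const.sub (continuous_fourierZ h.isProbability.hasSum.summable.norm))
    (sub_eq_zero.2 (fourierZ_zero h.isProbability).symm) ha ha1
    (fun ξ hξ hξ0 => (hderiv ξ (abs_le.1 hξ) hξ0).1.const_sub 1) fun ξ hξ hξ0 => ?_⟩
  rw [deriv_const_sub, norm_neg]
  exact (hderiv ξ (abs_le.1 hξ) hξ0).2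

theorem rpow_neg_half_mul_rpow_neg_half {s a : ℝ} (hs : 0 < s) (ha : a ≠ 0) :
    s ^ (-(1 / 2) : ℝ) * (s ^ (1 / a)) ^ (-(a / 2)) = s⁻¹ := by
  rw [← Real.rpow_mul hs.le, ← Real.rpow_add hs, ← Real.rpow_neg_one]
  congr 1
  field_simp
  norm_num

theorem FourierCriterion.mem_rittClass {a : ℝ} (h : FourierCriterion a F) (ha : 0 < a)
    (ha1 : a < 1) : F ∈ rittClass := by
  have hFs := h.isProbability.hasSum.summable.norm
  have hcont : Continuous fun ξ => 1 - fourierZ F ξ :=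
    continuous_const.sub (continuous_fourierZ hFs)
  obtain ⟨C, hC⟩ := h.exists_powerBound ha ha1.le
  obtain ⟨ε, hε, -, -, -, hre, -⟩ := h.bounds
  obtain ⟨c, hc, hdecay⟩ := exists_norm_fourierZ_le_exp h.isProbability h.aperiodic ha hε
    (fun ξ hξ => hre ξ (abs_le.1 hξ)) hC.norm_le
  have hexp : ∀ ξ, |ξ| ≤ Real.pi → ‖1 - (1 - fourierZ F ξ)‖ ≤ Real.exp (-(c * |ξ| ^ a)) := by
    simpa only [sub_sub_cancel] using hdecay
  obtain ⟨A, -, hA⟩ := exists_powerBound_one_sub_pow_mul hC ha.le hc hexp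
  obtain ⟨B, hB0, hB⟩ := exists_mul_integral_norm_sq_one_sub_pow_mul_le hcont hC ha hc hexp
  set J := √(∫ x : ℝ, (1 + ‖x‖) ^ (-(2 * (1 - a / 2))))
  refine mem_rittClass_of_tsum_norm_sub_le (K := 2 * B + 12 * A * J / (1 - 2 ^ (-(a / 2))))
    h.isProbability fun n hn => ?_
  have hn1 : (1 : ℝ) ≤ n := by exact_mod_cast hn
  have hfourier := fourierC_convPow_sub_convPow_succ hFs n
  have hbound := tsum_norm_le_of_powerBound (B := B / n) (M := (n : ℝ) ^ (1 / a))
    (by simpa only [Complex.norm_real] using summable_norm_convPow_sub_succ hFs n)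
    (hfourier ▸ hA n hn) (by linarith) (by linarith) (by positivity)
    (Real.one_le_rpow hn1 (by positivity)) (by simpa only [hfourier] using hB n hn)
  simp only [Complex.norm_real] at hbound
  calc (n : ℝ) * ∑' k, ‖convPow F n k - convPow F (n + 1) k‖
      ≤ n * (2 * (B / n) + 12 * A * J * ((n : ℝ) ^ (-(1 / 2) : ℝ) *
          ((n : ℝ) ^ (1 / a)) ^ (-(a / 2))) / (1 - 2 ^ (-(a / 2)))) := by
        gcongr
        refine hbound.trans_eq ?_
        ring
    _ = 2 * B + 12 * A * J / (1 - 2 ^ (-(a / 2))) := by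
        rw [rpow_neg_half_mul_rpow_neg_half (by linarith) ha.ne']
        field_simp

end RittClass

section PowerSum

variable {ι : Type*} [Fintype ι] {c α : ι → ℝ}

theorem antitoneOn_sum_mul_rpow (hc : ∀ j, 0 ≤ c j) (hα : ∀ j, 0 ≤ α j) :
    AntitoneOn (fun k : ℕ => ∑ j, c j * (k : ℝ) ^ (-1 - α j)) (Set.Ici 1) := by
  intro k hk l _ hkl
  have hk0 : (0 : ℝ) < k := by exact_mod_cast Set.mem_Ici.1 hk
  refine Finset.sum_le_sum fun j _ => mul_le_mul_of_nonneg_left ?_ (hc j)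
  exact Real.rpow_le_rpow_of_nonpos hk0 (by exact_mod_cast hkl) (by linarith [hα j])

theorem sum_mul_rpow_le {a x : ℝ} (hx : 1 ≤ x) (hc : ∀ j, 0 ≤ c j) (hα : ∀ j, a ≤ α j) :
    ∑ j, c j * x ^ (-1 - α j) ≤ (∑ j, c j) * x ^ (-1 - a) := by
  rw [Finset.sum_mul]
  refine Finset.sum_le_sum fun j _ => mul_le_mul_of_nonneg_left ?_ (hc j)
  exact Real.rpow_le_rpow_of_exponent_le hx (by linarith [hα j])

end PowerSum

end RittProbability

theorem theorem5p5_general {F b : ℕ → ℝ} {a c C : ℝ} (hF : RittProbability.IsProbability F)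
    (ha : 0 < a) (ha1 : a < 1) (hc : 0 < c) (hanti : AntitoneOn b (Set.Ici 1))
    (hlow : ∀ k : ℕ, 1 ≤ k → c * (k : ℝ) ^ (-1 - a) ≤ b k)
    (hup : ∀ k : ℕ, 1 ≤ k → b k ≤ C * (k : ℝ) ^ (-1 - a))
    (hFb : Summable fun k : ℕ => (k : ℝ) * |F k - b k|) :
    RittProbability.FourierCriterion a F ∧ F ∈ RittProbability.rittClass :=
  have hcrit := RittProbability.fourierCriterion_of_antitoneOn hF ha ha1 hc hanti hlow hup hFb
  ⟨hcrit, hcrit.mem_rittClass ha ha1⟩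

theorem theorem5p5 (N : ℕ) (hN : 0 < N) (α c : Fin N → ℝ)
    (hα_mono : StrictMono α) (hα_pos : ∀ j, 0 < α j) (hα_lt : ∀ j, α j < 1)
    (hc : ∀ j, 0 < c j)
    (F P : ℕ → ℝ) (hF : RittProbability.IsProbability F)
    (hP : Summable fun k : ℕ => (k : ℝ) * |P k|)
    (hFP : ∀ k : ℕ, 1 ≤ k → F k = (∑ j, c j * (k : ℝ) ^ (-1 - α j)) + P k) :
    RittProbability.FourierCriterion (α ⟨0, hN⟩) F ∧ F ∈ RittProbability.rittClass := by
  refine theorem5p5_general hF (hα_pos _) (hα_lt _) (hc ⟨0, hN⟩)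
    (RittProbability.antitoneOn_sum_mul_rpow (fun j => (hc j).le) fun j => (hα_pos j).le)
    (fun k _ => Finset.single_le_sum (f := fun j => c j * (k : ℝ) ^ (-1 - α j))
      (fun j _ => mul_nonneg (hc j).le (by positivity)) (Finset.mem_univ _))
    (fun k hk => RittProbability.sum_mul_rpow_le (by exact_mod_cast hk) (fun j => (hc j).le)
      fun j => hα_mono.monotone (Fin.mk_le_of_le_val (Nat.zero_le _)))
    (hP.congr fun k => ?_)
  rcases Nat.eq_zero_or_pos k with rfl | hk
  · simp
  · rw [hFP k hk, add_sub_cancel_left]
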